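/- **Setting.** A *pseudo-Euclidean space* is a finite-dimensional real vector space $V$ with a nondegenerate symmetric bilinear form $(\cdot,\cdot)$ of arbitrary signature; here $\dim V=2N$. A *submanifold* is a smooth parametrized immersion $r:\Omega\to V$, $\Omega\subset\mathbb R^N$ open, whose first fundamental form $g_{ij}=(r_{u^i},r_{u^j})$ is nondegenerate; $\Gamma^k_{ij}$ and $\nabla$ denote the Christoffel symbols and the Levi-Civita covariant differentiation of $g$. For a smooth frame $n_1,\dots,n_N$ of normal fields the second fundamental forms are $(\omega_i)_{jk}=(n_i,r_{u^ju^k})$ and the torsion coefficients are $\varkappa_{ij,k}=(n_{i,u^k},n_j)$. The submanifold is *flat* if the curvature tensor of $g$ vanishes, and *torsionless* if near each point there is a normal frame with constant Gram matrix and vanishing torsion coefficients. A flat torsionless submanifold is *potential* if near each point there are a smooth function $\Phi$ (a potential) and a normal frame $n_1,\dots,n_N$ such that $(\omega_i)_{jk}=\nabla_i\nabla_j\nabla_k\Phi$, where the frame is covariantly labelled by the coordinate index and torsionless, i.e. the normal part of $\partial n_i/\partial u^j$ is $\Gamma^k_{ij}n_k$ (in flat coordinates: $\varkappa_{ij,k}=0$).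 For a constant nondegenerate symmetric matrix $\eta=(\eta_{ij})$ with inverse $(\eta^{ij})$, the associativity (WDVV) equations for a smooth function $\Phi(u^1,\dots,u^N)$ are $$\sum_{k,l}\frac{\partial^3\Phi}{\partial u^i\partial u^j\partial u^k}\,\eta^{kl}\,\frac{\partial^3\Phi}{\partial u^l\partial u^m\partial u^n}=\sum_{k,l}\frac{\partial^3\Phi}{\partial u^i\partial u^m\partial u^k}\,\eta^{kl}\,\frac{\partial^3\Phi}{\partial u^l\partial u^j\partial u^n}\qquad\text{for all } i,j,m,n .$$ Say that $(r,n)$ *has the data* $(\eta,\mu,\Phi)$ on $\Omega$ if on $\Omega$: $g_{ij}=\eta_{ij}$, $n=(n_1,\dots,n_N)$ is a normal frame with constant Gram matrix $(n_i,n_j)=\mu_{ij}$ and vanishing torsion coefficients, and $(\omega_i)_{jk}=\partial^3\Phi/\partial u^i\partial u^j\partial u^k$. **Theorem.** The solutions of the associativity equations correspond exactly, up to motions, to the potential flat torsionless $N$-dimensional submanifolds of $2N$-dimensional pseudo-Euclidean spaces. Precisely, let $V$ be a $2N$-dimensional pseudo-Euclidean space. 1. Let $\eta$ be a nondegenerate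 symmetric $N\times N$ matrix and $c\neq0$, and suppose that in some basis of $V$ the Gram matrix is block diagonal with blocks $\eta$ and $c^{-1}\eta$. Let $\Phi$ be a smooth function on a simply connected open set $\Omega\subset\mathbb R^N$. Then $\Phi$ satisfies the associativity equations on $\Omega$ if and only if there are a potential flat torsionless submanifold $r:\Omega\to V$ and a normal frame $n$ such that $(r,n)$ has the data $(\eta,c^{-1}\eta,\Phi)$. 2. Let $\Omega$ be open and connected, and let $(r,n)$ and $(r',n')$ in $V$ have the data $(\eta,\mu,\Phi)$ and $(\eta,\mu,\Phi')$ on $\Omega$, with $\Phi,\Phi'$ smooth. There is a motion $x\mapsto Ax+w$ of $V$ ($A$ a linear isometry) with $r'=Ar+w$ and $n_i'=An_i$ for all $i$ if and only if $\Phi'-\Phi$ is a polynomial of degree at most $2$ on $\Omega$. In particular, the submanifold in 1 is unique up to motions. 3. Conversely, let $r:\Omega\to V$ be any potential flat torsionless submanifold and let $\Phi$ be a potential of it on an open set $W\subset\Omega$, with frame $n_1,\dots,n_N$. Near each point of $W$ there are flat coordinates $x$ in which $r$, with the frame $\sum_i(\partial u^i/\partial x^a)\,n_i$, $1\le a\le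 N$, has data $(\eta,\mu,\Phi)$ for some constant nondegenerate symmetric matrices $\eta,\mu$; thus its second fundamental forms are the third derivatives of $\Phi$, and $\Phi$ satisfies the associativity equations with the metric $\eta$. -/

import Mathlib

open scoped ContDiff

namespace PotentialSubmanifold

/-- The partial derivative `∂f/∂uⁱ` of a function on `ℝᴺ`. -/
noncomputable def pd {N : ℕ} {F : Type*} [NormedAddCommGroup F] [NormedSpace ℝ F]
    (i : Fin N) (f : (Fin N → ℝ) → F) (u : Fin N → ℝ) : F :=
  fderiv ℝ f u (Pi.single i 1)

/-! ### The associativity equations -/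

/-- The associativity (WDVV) equations on `Ω` for the potential `Φ`, with the constant metric
`η = (η_{ij})`; the matrix `(η^{kl})` of the equations is the inverse matrix `η⁻¹`. -/
def SatisfiesWDVV {N : ℕ} (η : Matrix (Fin N) (Fin N) ℝ) (Ω : Set (Fin N → ℝ))
    (Φ : (Fin N → ℝ) → ℝ) : Prop :=
  ∀ u ∈ Ω, ∀ i j m n : Fin N,
    ∑ k, ∑ l, pd i (pd j (pd k Φ)) u * η⁻¹ k l * pd l (pd m (pd n Φ)) u =
      ∑ k, ∑ l, pd i (pd m (pd k Φ)) u * η⁻¹ k l * pd l (pd j (pd n Φ)) u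

/-! ### Levi-Civita connection and curvature of a metric in local coordinates -/

/-- The Christoffel symbol `Γ^k_{ij}` of the metric `g`. -/
noncomputable def christoffel {N : ℕ} (g : (Fin N → ℝ) → Matrix (Fin N) (Fin N) ℝ)
    (k i j : Fin N) (u : Fin N → ℝ) : ℝ :=
  (1 / 2 : ℝ) * ∑ l, (g u)⁻¹ k l *
    (pd i (fun v => g v j l) u + pd j (fun v => g v i l) u - pd l (fun v => g v i j) u)

/-- The component `R^l_{kij}` of the Riemann curvature tensor of the metric `g`. -/
noncomputable def riemann {N : ℕ} (g : (Fin N → ℝ) → Matrix (Fin N) (Fin N) ℝ)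
    (l k i j : Fin N) (u : Fin N → ℝ) : ℝ :=
  pd i (christoffel g l j k) u - pd j (christoffel g l i k) u +
    ∑ m, (christoffel g l i m u * christoffel g m j k u -
      christoffel g l j m u * christoffel g m i k u)

/-- The second covariant derivative `∇_j ∇_k Φ`. -/
noncomputable def cov2 {N : ℕ} (g : (Fin N → ℝ) → Matrix (Fin N) (Fin N) ℝ)
    (Φ : (Fin N → ℝ) → ℝ) (j k : Fin N) (u : Fin N → ℝ) : ℝ :=
  pd j (pd k Φ) u - ∑ m, christoffel g m j k u * pd m Φ u

/-- The third covariant derivative `∇_i ∇_j ∇_k Φ`. -/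
noncomputable def cov3 {N : ℕ} (g : (Fin N → ℝ) → Matrix (Fin N) (Fin N) ℝ)
    (Φ : (Fin N → ℝ) → ℝ) (i j k : Fin N) (u : Fin N → ℝ) : ℝ :=
  pd i (cov2 g Φ j k) u -
    ∑ m, (christoffel g m i j u * cov2 g Φ m k u + christoffel g m i k u * cov2 g Φ j m u)

/-! ### Submanifolds of a pseudo-Euclidean space

The ambient pseudo-Euclidean space is a finite-dimensional real vector space `V` with a
nondegenerate symmetric bilinear form `B`; the norm of `V` serves only for differentiation.
A submanifold is given by a parametrization `r` on an open set of parameters `u ∈ ℝᴺ`. -/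

section

variable {N : ℕ} {V : Type*} [NormedAddCommGroup V] [NormedSpace ℝ V]

/-- The first fundamental form `g_{ij}(u) = (r_{uⁱ}, r_{uʲ})`. -/
noncomputable def firstForm (B : LinearMap.BilinForm ℝ V) (r : (Fin N → ℝ) → V)
    (u : Fin N → ℝ) : Matrix (Fin N) (Fin N) ℝ :=
  Matrix.of fun i j => B (pd i r u) (pd j r u)

/-- The coefficient `(n, r_{uʲuᵏ})` of the second fundamental form of the normal field `n`. -/
noncomputable def secondForm (B : LinearMap.BilinForm ℝ V) (r : (Fin N → ℝ) → V)
    (n : (Fin N → ℝ) → V) (j k : Fin N) (u : Fin N → ℝ) : ℝ :=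
  B (n u) (pd j (pd k r) u)

/-- The torsion coefficient `ϰ_{αβ,i} = (n_{α,uⁱ}, n_β)` of a frame of normal fields. -/
noncomputable def torsionCoeff (B : LinearMap.BilinForm ℝ V) (n : Fin N → (Fin N → ℝ) → V)
    (α β i : Fin N) (u : Fin N → ℝ) : ℝ :=
  B (pd i (n α) u) (n β u)

/-- `r` is a smooth totally nonisotropic `N`-dimensional (immersed) submanifold over `Ω`. -/
structure IsSubmanifold (B : LinearMap.BilinForm ℝ V) (Ω : Set (Fin N → ℝ))
    (r : (Fin N → ℝ) → V) : Prop where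
  smooth : ContDiffOn ℝ ∞ r Ω
  rank : ∀ u ∈ Ω, LinearIndependent ℝ (fun i => pd i r u)
  nonisotropic : ∀ u ∈ Ω, (firstForm B r u).det ≠ 0

/-- The first fundamental form of `r` is flat: its curvature tensor vanishes. -/
def IsFlat (B : LinearMap.BilinForm ℝ V) (Ω : Set (Fin N → ℝ)) (r : (Fin N → ℝ) → V) : Prop :=
  ∀ u ∈ Ω, ∀ l k i j : Fin N, riemann (firstForm B r) l k i j u = 0

/-- `n₁, …, n_N` is a smooth frame of normal fields over `Ω`. For a nonisotropic `N`-dimensional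
submanifold of a `2N`-dimensional space it is a basis of the normal space at each point. -/
structure IsNormalFrame (B : LinearMap.BilinForm ℝ V) (Ω : Set (Fin N → ℝ))
    (r : (Fin N → ℝ) → V) (n : Fin N → (Fin N → ℝ) → V) : Prop where
  smooth : ∀ α, ContDiffOn ℝ ∞ (n α) Ω
  normal : ∀ u ∈ Ω, ∀ α i, B (n α u) (pd i r u) = 0
  independent : ∀ u ∈ Ω, LinearIndependent ℝ (fun α => n α u)

/-- The submanifold (of codimension `N`) is torsionless: near each point it has a normal frame with
a constant Gram matrix for which all torsion forms vanish. -/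
def IsTorsionless (B : LinearMap.BilinForm ℝ V) (Ω : Set (Fin N → ℝ))
    (r : (Fin N → ℝ) → V) : Prop :=
  ∀ p ∈ Ω, ∃ W : Set (Fin N → ℝ), IsOpen W ∧ p ∈ W ∧ W ⊆ Ω ∧
    ∃ (n : Fin N → (Fin N → ℝ) → V) (μ : Matrix (Fin N) (Fin N) ℝ),
      IsNormalFrame B W r n ∧
      (∀ u ∈ W, ∀ α β, B (n α u) (n β u) = μ α β) ∧
      (∀ u ∈ W, ∀ α β i, torsionCoeff B n α β i u = 0)

/-- `Φ` is a potential over `W` of the flat submanifold `r`, with respect to the normal frame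
`n₁, …, n_N`, in arbitrary local coordinates: the second fundamental forms are
`(ω_i)_{jk} = ∇_i ∇_j ∇_k Φ`. As `i` is here also a coordinate index, the frame is a covector
with respect to it, `n_i = ∂xᵃ/∂uⁱ m_a` with `xᵃ` flat coordinates and `m_a` a frame
with vanishing torsion forms; in the coordinates `u` this says that the normal part of
`∂n_i/∂uʲ` is `Γ^k_{ij} n_k`. In flat coordinates `Γ = 0` and the torsion forms of `n` itself
vanish. -/
structure IsPotential (B : LinearMap.BilinForm ℝ V) (W : Set (Fin N → ℝ))
    (r : (Fin N → ℝ) → V) (n : Fin N → (Fin N → ℝ) → V) (Φ : (Fin N → ℝ) → ℝ) : Prop where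
  smooth : ContDiffOn ℝ ∞ Φ W
  frame : IsNormalFrame B W r n
  parallel : ∀ u ∈ W, ∀ i j l,
    torsionCoeff B n i l j u =
      ∑ k, christoffel (firstForm B r) k i j u * B (n k u) (n l u)
  second : ∀ u ∈ W, ∀ i j k, secondForm B r (n i) j k u = cov3 (firstForm B r) Φ i j k u

/-- `r` is a potential flat torsionless submanifold: it is flat and torsionless, and near each
point its second fundamental forms are the third covariant derivatives of some function. -/
structure IsPotentialSubmanifold (B : LinearMap.BilinForm ℝ V) (Ω : Set (Fin N → ℝ))
    (r : (Fin N → ℝ) → V) : Prop where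
  submanifold : IsSubmanifold B Ω r
  flat : IsFlat B Ω r
  torsionless : IsTorsionless B Ω r
  potential : ∀ p ∈ Ω, ∃ W : Set (Fin N → ℝ), IsOpen W ∧ p ∈ W ∧ W ⊆ Ω ∧
    ∃ (n : Fin N → (Fin N → ℝ) → V) (Φ : (Fin N → ℝ) → ℝ), IsPotential B W r n Φ

/-- The submanifold `r` with the normal frame `n` has, in the flat coordinates `u ∈ Ω`, the first
fundamental form `η_{ij} duⁱ duʲ`, the constant Gram matrix `(n_i, n_j) = μ_{ij}` of normals,
vanishing torsion forms and the second fundamental forms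
`ω_i = (∂³Φ / ∂uⁱ ∂uʲ ∂uᵏ) duʲ duᵏ`. -/
structure HasFundamentalForms (B : LinearMap.BilinForm ℝ V) (η μ : Matrix (Fin N) (Fin N) ℝ)
    (Ω : Set (Fin N → ℝ)) (r : (Fin N → ℝ) → V) (n : Fin N → (Fin N → ℝ) → V)
    (Φ : (Fin N → ℝ) → ℝ) : Prop where
  submanifold : IsSubmanifold B Ω r
  frame : IsNormalFrame B Ω r n
  first : ∀ u ∈ Ω, firstForm B r u = η
  gram : ∀ u ∈ Ω, ∀ i j, B (n i u) (n j u) = μ i j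
  torsion : ∀ u ∈ Ω, ∀ i j k, torsionCoeff B n i j k u = 0
  second : ∀ u ∈ Ω, ∀ i j k, secondForm B r (n i) j k u = pd i (pd j (pd k Φ)) u

/-- The submanifolds `r`, `r'` with their normal frames `n`, `n'` coincide up to a motion
`x ↦ A x + w` of the ambient space. -/
def EqualUpToMotion (B : LinearMap.BilinForm ℝ V) (Ω : Set (Fin N → ℝ))
    (r : (Fin N → ℝ) → V) (n : Fin N → (Fin N → ℝ) → V)
    (r' : (Fin N → ℝ) → V) (n' : Fin N → (Fin N → ℝ) → V) : Prop :=
  ∃ (A : V ≃ₗ[ℝ] V) (w : V), (∀ x y, B (A x) (A y) = B x y) ∧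
    ∀ u ∈ Ω, r' u = A (r u) + w ∧ ∀ i, n' i u = A (n i u)

end

end PotentialSubmanifold

open PotentialSubmanifold

/-! In flat coordinates the frame X = (r_{u¹}, …, r_{uᴺ}, n₁, …, n_N) of a flat torsionless
submanifold has the constant Gram matrix diag(η, μ) and satisfies a linear system ∂ⱼX = AⱼX, whose
coefficients are the second fundamental forms contracted with η⁻¹ and μ⁻¹. Compatibility of this
system splits into the Codazzi equations (mixed blocks), the Gauss equations (tangent block) and the
Ricci equations (normal block). If the second fundamental forms are the third derivatives of Φ, the
Codazzi equations follow from the symmetry of fourth derivatives, and the Ricci equations are the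
associativity equations. For μ = c⁻¹η the Gauss equations are the same equations once more, so
associativity is exactly integrability.

Existence is therefore a Frobenius theorem on a simply connected domain, with r as an extra unknown
(`exists_frame_and_primitive`). The Gram matrix keeps its initial value because the connection
coefficients are skew (`IsMovingFrame.gram_eq`). The converse is
`HasFundamentalForms.satisfiesWDVV`. For uniqueness, the linear map carrying one frame to another
with equal coefficients does not depend on the point (`IsMovingFrame.transport_eq`), and it is an
isometry; conversely a motion preserves the third derivatives, which determine Φ up to a quadratic
polynomial. In arbitrary coordinates, zero curvature gives N parallel covector fields, which
integrate to flat coordinates (`exists_flatChart`); there covariant derivatives become partial ones.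

The Frobenius theorem is obtained locally by integrating along rays, and globally by lifting the
identity to the covering space formed by the local solutions. -/

namespace PotentialSubmanifold

open Set Metric Filter Topology NNReal

/-! ### Local solvability of dG = A G by integration along rays. -/

section TotalDifferential

variable {M R : Type*} [NormedAddCommGroup M] [NormedSpace ℝ M]
  [NormedRing R] [NormedAlgebra ℝ R]

/-- The connection form `A` with values in the algebra `R` is flat on `Ω`: the system
`dG = A G` satisfies the Frobenius integrability condition. -/
def IsFlatForm (A : M → M →L[ℝ] R) (Ω : Set M) : Prop :=
  ∀ u ∈ Ω, ∀ a b, fderiv ℝ A u a b + A u b * A u a = fderiv ℝ A u b a + A u a * A u b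

/-- `G` solves the linear total differential system `dG = A G` at `u`. -/
def SolvesAt (A : M → M →L[ℝ] R) (G : M → R) (u : M) : Prop :=
  HasFDerivAt G ((ContinuousLinearMap.mul ℝ R).flip (G u) ∘L A u) u

/-- Grönwall with rate 1 over time 1 gives c (e - 1), and e ≤ 3. All radial equations below are
parametrized by the unit interval, with coefficients of norm at most 1, so this one form serves each
of them. -/
theorem norm_le_of_norm_deriv_le_add {E : Type*} [NormedAddCommGroup E] [NormedSpace ℝ E]
    {f f' : ℝ → E} {c : ℝ} (hc : 0 ≤ c)
    (hf : ∀ t ∈ Icc (0 : ℝ) 1, HasDerivWithinAt f (f' t) (Icc 0 1) t) (h0 : f 0 = 0)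
    (hb : ∀ t ∈ Icc (0 : ℝ) 1, ‖f' t‖ ≤ ‖f t‖ + c) : ∀ t ∈ Icc (0 : ℝ) 1, ‖f t‖ ≤ 2 * c := by
  intro t ht
  have h := norm_le_gronwallBound_of_norm_deriv_right_le (f := f) (f' := f') (δ := 0) (K := 1)
    (ε := c) (a := 0) (b := 1) (fun t ht => (hf t ht).continuousWithinAt)
    (fun t ht => (hf t ⟨ht.1, ht.2.le⟩).mono_of_mem_nhdsWithin
      (Icc_mem_nhdsGE_of_mem ht)) (by simp [h0])
    (fun t ht => by simpa using hb t ⟨ht.1, ht.2.le⟩) t ht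
  rw [gronwallBound_of_K_ne_0 one_ne_zero] at h
  have he : Real.exp (1 * (t - 0)) ≤ 3 := by
    have : Real.exp (1 * (t - 0)) ≤ Real.exp 1 := Real.exp_le_exp.2 (by linarith [ht.2])
    linarith [Real.exp_one_lt_d9]
  refine h.trans ?_
  have : c * (Real.exp (1 * (t - 0)) - 1) ≤ c * 2 := by gcongr; linarith
  linarith

theorem exists_radial_solution [CompleteSpace R] {A : M → M →L[ℝ] R} {p u : M} {ε C : ℝ}
    (hC : 0 ≤ C) (hεC : ε * C ≤ 1 / 2) (hA : ContinuousOn A (ball p ε))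
    (hAC : ∀ v ∈ ball p ε, ‖A v‖ ≤ C) (hu : u ∈ ball p ε) :
    ∃ Y : ℝ → R, Y 0 = 1 ∧ ∀ t ∈ Icc (0 : ℝ) 1,
      HasDerivWithinAt Y (A (p + t • (u - p)) (u - p) * Y t) (Icc 0 1) t := by
  have hmem : ∀ t ∈ Icc (0 : ℝ) 1, p + t • (u - p) ∈ ball p ε := by
    intro t ht
    have := (convex_ball p ε).add_smul_sub_mem (mem_ball_self (pos_of_mem_ball hu)) hu ht
    simpa using this
  have hx : ‖u - p‖ ≤ ε := by rw [← dist_eq_norm]; exact (mem_ball.1 hu).le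
  have hn : ∀ t ∈ Icc (0 : ℝ) 1, ‖A (p + t • (u - p)) (u - p)‖ ≤ 1 / 2 := fun t ht =>
    calc ‖A (p + t • (u - p)) (u - p)‖ ≤ ‖A (p + t • (u - p))‖ * ‖u - p‖ :=
          ContinuousLinearMap.le_opNorm _ _
      _ ≤ C * ε := by gcongr; exact hAC _ (hmem t ht)
      _ ≤ 1 / 2 := by linarith
  -- On the ball of radius ‖1‖ + 1 about the initial value 1 one has ‖y‖ ≤ 2‖1‖ + 1; as the
  -- coefficient is at most 1/2, the speed is at most the radius and the solution survives to time
  -- one. The norm of the unit of R need not be 1.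
  have hPL : IsPicardLindelof (fun t (y : R) => A (p + t • (u - p)) (u - p) * y)
      (⟨0, by simp⟩ : Icc (0 : ℝ) 1) (1 : R) (‖(1 : R)‖₊ + 1) 0 (‖(1 : R)‖₊ + 1) 1 := by
    refine ⟨fun t ht => ?_, fun x _ => ?_, fun t ht y hy => ?_, by simp⟩
    · refine LipschitzOnWith.of_dist_le_mul fun y _ z _ => ?_
      rw [dist_eq_norm, dist_eq_norm, ← mul_sub]
      refine (norm_mul_le _ _).trans ?_
      gcongr
      simpa using (hn t ht).trans (by norm_num)
    · refine ContinuousOn.mul ?_ continuousOn_const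
      refine ContinuousOn.clm_apply (hA.comp (by fun_prop) hmem) continuousOn_const
    · have hy' : ‖y‖ ≤ 2 * ‖(1 : R)‖ + 1 := by
        have h1 : ‖y - 1‖ ≤ ‖(1 : R)‖ + 1 := by
          rw [← dist_eq_norm]; simpa using hy
        have h2 : ‖y‖ ≤ ‖y - 1‖ + ‖(1 : R)‖ := by simpa using norm_add_le (y - 1) 1
        linarith
      calc ‖A (p + t • (u - p)) (u - p) * y‖ ≤ 1 / 2 * (2 * ‖(1 : R)‖ + 1) := by
            refine (norm_mul_le _ _).trans ?_
            gcongr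
            exact hn t ht
        _ ≤ ‖(1 : R)‖ + 1 := by linarith
  simpa using hPL.exists_eq_forall_mem_Icc_hasDerivWithinAt₀

/-- The ray equation controls only the radial derivative. For a displacement h of the endpoint, the
variation of the ray solution should be A(v)(t h) Y at time t; flatness cancels the first-order
terms in the equation for the error, so Grönwall leaves an error O(‖h‖²) at t = 1. -/
theorem solvesAt_of_radial_solution {A : M → M →L[ℝ] R} {p : M} {ε C : ℝ}
    (hC : 0 ≤ C) (hεC : ε * C ≤ 1 / 2) (hε1 : ε ≤ 1)
    (hd : ∀ v ∈ ball p ε, DifferentiableAt ℝ A v)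
    (hAC : ∀ v ∈ ball p ε, ‖A v‖ ≤ C)
    (hlip : ∀ v ∈ ball p ε, ∀ w ∈ ball p ε, ‖A w - A v‖ ≤ C * ‖w - v‖)
    (htay : ∀ v ∈ ball p ε, ∀ w ∈ ball p ε,
      ‖A w - A v - fderiv ℝ A v (w - v)‖ ≤ C * ‖w - v‖ ^ 2)
    (hflat : IsFlatForm A (ball p ε)) {Y : M → ℝ → R}
    (hY0 : ∀ u ∈ ball p ε, Y u 0 = 1)
    (hY : ∀ u ∈ ball p ε, ∀ t ∈ Icc (0 : ℝ) 1,
      HasDerivWithinAt (Y u) (A (p + t • (u - p)) (u - p) * Y u t) (Icc 0 1) t)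
    {u : M} (hu : u ∈ ball p ε) : SolvesAt A (fun u => Y u 1) u := by
  have hε : 0 < ε := pos_of_mem_ball hu
  have hmem : ∀ u ∈ ball p ε, ∀ t ∈ Icc (0 : ℝ) 1, p + t • (u - p) ∈ ball p ε := by
    intro u hu t ht
    have := (convex_ball p ε).add_smul_sub_mem (mem_ball_self hε) hu ht
    simpa using this
  have hx : ∀ u ∈ ball p ε, ‖u - p‖ ≤ ε := fun u hu => by
    rw [← dist_eq_norm]; exact (mem_ball.1 hu).le
  have hn : ∀ u ∈ ball p ε, ∀ v ∈ ball p ε, ‖A v (u - p)‖ ≤ 1 := fun u hu v hv =>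
    calc ‖A v (u - p)‖ ≤ ‖A v‖ * ‖u - p‖ := ContinuousLinearMap.le_opNorm _ _
      _ ≤ C * ε := by gcongr; exacts [hAC _ hv, hx u hu]
      _ ≤ 1 := by linarith
  set b : ℝ := 3 * ‖(1 : R)‖ with hb
  have hb0 : 0 ≤ b := by positivity
  have hYb : ∀ u ∈ ball p ε, ∀ t ∈ Icc (0 : ℝ) 1, ‖Y u t‖ ≤ b := by
    intro u hu t ht
    have h := norm_le_of_norm_deriv_le_add (f := fun t => Y u t - 1) (norm_nonneg (1 : R))
      (fun t ht => (hY u hu t ht).sub_const 1) (by simp [hY0 u hu])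
      (fun t ht => by
        refine (norm_mul_le _ _).trans ?_
        have h1 : ‖Y u t‖ ≤ ‖Y u t - 1‖ + ‖(1 : R)‖ := by simpa using norm_add_le (Y u t - 1) 1
        refine le_trans ?_ h1
        exact mul_le_of_le_one_left (norm_nonneg _) (hn u hu _ (hmem u hu t ht))) t ht
    have h1 : ‖Y u t‖ ≤ ‖Y u t - 1‖ + ‖(1 : R)‖ := by simpa using norm_add_le (Y u t - 1) 1
    linarith
  -- The outer 2 is the Grönwall factor; inside are 2C‖h‖ (coefficient difference) times 4Cb‖h‖
  -- (solution difference), and the Taylor remainder 2C‖h‖² times b.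
  set K : ℝ := 2 * (8 * C ^ 2 * b + 2 * C * b) with hK
  have key : ∀ h : M, u + h ∈ ball p ε →
      ‖Y (u + h) 1 - Y u 1 - A u h * Y u 1‖ ≤ K * ‖h‖ ^ 2 := by
    intro h huh
    set x := u - p with hxdef
    have hxh : u + h - p = x + h := by rw [hxdef]; abel
    set v : ℝ → M := fun t => p + t • x with hv
    set w : ℝ → M := fun t => p + t • (x + h) with hw
    have hwv : ∀ t, w t - v t = t • h := fun t => by simp [hv, hw, smul_add]
    have hvm : ∀ t ∈ Icc (0 : ℝ) 1, v t ∈ ball p ε := hmem u hu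
    have hwm : ∀ t ∈ Icc (0 : ℝ) 1, w t ∈ ball p ε := fun t ht => by
      have := hmem _ huh t ht
      rwa [hxh] at this
    have hwvn : ∀ t ∈ Icc (0 : ℝ) 1, ‖w t - v t‖ ≤ ‖h‖ := fun t ht => by
      rw [hwv, norm_smul, Real.norm_of_nonneg ht.1]
      exact mul_le_of_le_one_left (norm_nonneg _) ht.2
    have hxn : ‖x‖ ≤ 1 := (hx u hu).trans hε1
    have hxhn : ‖x + h‖ ≤ 1 := by rw [← hxh]; exact (hx _ huh).trans hε1
    have hlip' : ∀ t ∈ Icc (0 : ℝ) 1, ‖A (w t) - A (v t)‖ ≤ C * ‖h‖ := fun t ht =>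
      (hlip _ (hvm t ht) _ (hwm t ht)).trans (by gcongr; exact hwvn t ht)
    have hbr : ∀ t ∈ Icc (0 : ℝ) 1, ‖A (w t) (x + h) - A (v t) x‖ ≤ 2 * C * ‖h‖ := by
      intro t ht
      have e : A (w t) (x + h) - A (v t) x = (A (w t) - A (v t)) (x + h) + A (v t) h := by
        simp only [sub_apply, map_add]; abel
      rw [e]
      calc _ ≤ ‖A (w t) - A (v t)‖ * ‖x + h‖ + ‖A (v t)‖ * ‖h‖ :=
            (norm_add_le _ _).trans (add_le_add (ContinuousLinearMap.le_opNorm _ _)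
              (ContinuousLinearMap.le_opNorm _ _))
        _ ≤ (C * ‖h‖) * 1 + C * ‖h‖ := by
            gcongr
            exacts [hlip' t ht, hAC _ (hvm t ht)]
        _ = _ := by ring
    have hbr2 : ∀ t ∈ Icc (0 : ℝ) 1,
        ‖A (w t) (x + h) - A (v t) x - A (v t) h - fderiv ℝ A (v t) (t • h) x‖
          ≤ 2 * C * ‖h‖ ^ 2 := by
      intro t ht
      have e : A (w t) (x + h) - A (v t) x - A (v t) h - fderiv ℝ A (v t) (t • h) x =
          (A (w t) - A (v t) - fderiv ℝ A (v t) (w t - v t)) x + (A (w t) - A (v t)) h := by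
        simp only [sub_apply, map_add, hwv]; abel
      rw [e]
      calc _ ≤ ‖A (w t) - A (v t) - fderiv ℝ A (v t) (w t - v t)‖ * ‖x‖
              + ‖A (w t) - A (v t)‖ * ‖h‖ :=
            (norm_add_le _ _).trans (add_le_add (ContinuousLinearMap.le_opNorm _ _)
              (ContinuousLinearMap.le_opNorm _ _))
        _ ≤ (C * ‖h‖ ^ 2) * 1 + (C * ‖h‖) * ‖h‖ := by
            gcongr
            · refine (htay _ (hvm t ht) _ (hwm t ht)).trans ?_
              gcongr
              exact hwvn t ht
            · exact hlip' t ht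
        _ = _ := by ring
    have hYh : ∀ t ∈ Icc (0 : ℝ) 1,
        HasDerivWithinAt (Y (u + h)) (A (w t) (x + h) * Y (u + h) t) (Icc 0 1) t := by
      intro t ht
      have := hY _ huh t ht
      rwa [hxh] at this
    set D : ℝ → R := fun t => Y (u + h) t - Y u t with hD
    have hDd : ∀ t ∈ Icc (0 : ℝ) 1, HasDerivWithinAt D
        (A (w t) (x + h) * D t + (A (w t) (x + h) - A (v t) x) * Y u t) (Icc 0 1) t := by
      intro t ht
      refine ((hYh t ht).sub (hY u hu t ht)).congr_deriv ?_
      simp only [hD, hv, hxdef]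
      noncomm_ring
    have hDb : ∀ t ∈ Icc (0 : ℝ) 1, ‖D t‖ ≤ 2 * (2 * C * ‖h‖ * b) := by
      refine norm_le_of_norm_deriv_le_add (by positivity) hDd
        (by simp [hD, hY0 u hu, hY0 _ huh]) fun t ht => ?_
      refine (norm_add_le _ _).trans (add_le_add ?_ ?_)
      · refine (norm_mul_le _ _).trans (mul_le_of_le_one_left (norm_nonneg _) ?_)
        rw [← hxh]
        exact hn _ huh _ (hwm t ht)
      · refine (norm_mul_le _ _).trans ?_
        gcongr
        exacts [hbr t ht, hYb u hu t ht]
    -- The error of the expected first variation along the ray.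
    set Z : ℝ → R := fun t => D t - A (v t) (t • h) * Y u t with hZ
    have hvd : ∀ t : ℝ, HasDerivAt v x t := fun t => by
      simpa [hv] using ((hasDerivAt_id t).smul_const x).const_add p
    have hAv : ∀ t ∈ Icc (0 : ℝ) 1, HasDerivWithinAt (fun t => A (v t) (t • h))
        (fderiv ℝ A (v t) x (t • h) + A (v t) h) (Icc 0 1) t := by
      intro t ht
      have h1 : HasDerivAt (fun t => A (v t)) (fderiv ℝ A (v t) x) t :=
        (hd _ (hvm t ht)).hasFDerivAt.comp_hasDerivAt t (hvd t)
      have h2 : HasDerivAt (fun t : ℝ => t • h) h t := by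
        simpa using (hasDerivAt_id t).smul_const h
      exact (h1.clm_apply h2).hasDerivWithinAt
    have hZd : ∀ t ∈ Icc (0 : ℝ) 1, HasDerivWithinAt Z
        (A (v t) x * Z t + ((A (w t) (x + h) - A (v t) x) * D t +
          (A (w t) (x + h) - A (v t) x - A (v t) h - fderiv ℝ A (v t) (t • h) x) * Y u t))
        (Icc 0 1) t := by
      intro t ht
      refine ((hDd t ht).sub ((hAv t ht).mul (hY u hu t ht))).congr_deriv ?_
      -- Flatness exchanges the derivative of A along the ray for its derivative in the direction t
      -- h, up to a commutator; the latter derivative is the one in the Taylor bound `hbr2`, and the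
      -- commutator combines into A(v) x Z.
      have hf := hflat _ (hvm t ht) x (t • h)
      have hf' : fderiv ℝ A (v t) x (t • h) =
        fderiv ℝ A (v t) (t • h) x + A (v t) x * A (v t) (t • h) - A (v t) (t • h) * A (v t) x := by
        rw [← hf]; abel
      rw [hf']
      change _ - (_ + A (v t) (t • h) * (A (v t) x * Y u t)) = _
      simp only [hZ]
      noncomm_ring
    have hZb := norm_le_of_norm_deriv_le_add
      (c := 2 * C * ‖h‖ * (2 * (2 * C * ‖h‖ * b)) + 2 * C * ‖h‖ ^ 2 * b) (by positivity) hZd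
      (by simp [hZ, hD, hY0 u hu, hY0 _ huh]) (fun t ht => by
        refine (norm_add_le _ _).trans (add_le_add ?_ ((norm_add_le _ _).trans (add_le_add ?_ ?_)))
        · exact (norm_mul_le _ _).trans
            (mul_le_of_le_one_left (norm_nonneg _) (hn u hu _ (hvm t ht)))
        · refine (norm_mul_le _ _).trans ?_
          gcongr
          exacts [hbr t ht, hDb t ht]
        · refine (norm_mul_le _ _).trans ?_
          gcongr
          exacts [hbr2 t ht, hYb u hu t ht]) 1 (by simp)
    have hv1 : v 1 = u := by simp [hv, hxdef]
    simp only [hZ, hD, hv1, one_smul] at hZb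
    refine hZb.trans (le_of_eq ?_)
    rw [hK]; ring
  have hO : HasFDerivAt (fun w => Y w 1 - Y u 1 - A u (w - u) * Y u 1) (0 : M →L[ℝ] R) u := by
    refine Asymptotics.IsBigO.hasFDerivAt (n := 2) ?_ one_lt_two
    refine Asymptotics.IsBigO.of_bound K ?_
    filter_upwards [isOpen_ball.mem_nhds hu] with w hw
    have := key (w - u) (by simpa using hw)
    simpa using this
  have h1 : HasFDerivAt (fun w => A u (w - u) * Y u 1)
      ((ContinuousLinearMap.mul ℝ R).flip (Y u 1) ∘L A u) u := by
    have hid : HasFDerivAt (fun w : M => w - u) (ContinuousLinearMap.id ℝ M) u :=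
      (hasFDerivAt_id u).sub_const u
    exact ((ContinuousLinearMap.mul ℝ R).flip (Y u 1) ∘L A u).hasFDerivAt.comp u hid
  have h2 := (hO.add h1).add_const (Y u 1)
  rw [zero_add] at h2
  refine h2.congr_of_eventuallyEq (Eventually.of_forall fun w => ?_)
  simp

/-- Local solvability of a flat linear total differential system. -/
theorem exists_local_solution [CompleteSpace R] {A : M → M →L[ℝ] R} {Ω : Set M} (hΩ : IsOpen Ω)
    (hA : ContDiffOn ℝ 2 A Ω) (hflat : IsFlatForm A Ω) {p : M} (hp : p ∈ Ω) :
    ∃ ε > 0, ball p ε ⊆ Ω ∧ ∃ G : M → R, G p = 1 ∧ ∀ u ∈ ball p ε, SolvesAt A G u := by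
  have hAp : ContDiffAt ℝ 2 A p := hA.contDiffAt (hΩ.mem_nhds hp)
  obtain ⟨K₁, t₁, ht₁, hK₁⟩ := (hAp.of_le one_le_two).exists_lipschitzOnWith
  obtain ⟨K₂, t₂, ht₂, hK₂⟩ := (hAp.fderiv_right (m := 1) (by norm_num)).exists_lipschitzOnWith
  have hbd : ∀ᶠ v in 𝓝 p, ‖A v‖ < ‖A p‖ + 1 :=
    hAp.continuousAt.norm.eventually_lt_const (by linarith)
  obtain ⟨δ, hδ, hδs⟩ := Metric.mem_nhds_iff.1
    (inter_mem (inter_mem ht₁ ht₂) (inter_mem hbd (hΩ.mem_nhds hp)))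
  set C : ℝ := max (‖A p‖ + 1) (max K₁ K₂) with hC
  have hCpos : 0 < C := lt_of_lt_of_le (by positivity) (le_max_left _ _)
  -- The three entries secure the bounds on A and its derivative, radius vectors of length at most
  -- 1, and ε C ≤ 1/2.
  set ε : ℝ := min δ (min 1 (1 / (2 * C))) with hεdef
  have hε : 0 < ε := by positivity
  have hεs : ball p ε ⊆ ball p δ := ball_subset_ball (min_le_left _ _)
  have hεΩ : ball p ε ⊆ Ω := fun v hv => (hδs (hεs hv)).2.2
  have hεC : ε * C ≤ 1 / 2 := by
    have : ε ≤ 1 / (2 * C) := (min_le_right _ _).trans (min_le_right _ _)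
    calc ε * C ≤ 1 / (2 * C) * C := by gcongr
      _ = 1 / 2 := by field_simp
  have hd : ∀ v ∈ ball p ε, DifferentiableAt ℝ A v := fun v hv =>
    (hA.contDiffAt (hΩ.mem_nhds (hεΩ hv))).differentiableAt (by norm_num)
  have hAC : ∀ v ∈ ball p ε, ‖A v‖ ≤ C := fun v hv =>
    (le_of_lt (hδs (hεs hv)).2.1).trans (le_max_left _ _)
  have hlip : ∀ v ∈ ball p ε, ∀ w ∈ ball p ε, ‖A w - A v‖ ≤ C * ‖w - v‖ := fun v hv w hw => by
    have := hK₁.dist_le_mul w (hδs (hεs hw)).1.1 v (hδs (hεs hv)).1.1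
    rw [dist_eq_norm, dist_eq_norm] at this
    refine this.trans ?_
    gcongr
    exact (le_max_left _ _).trans (le_max_right _ _)
  have htay : ∀ v ∈ ball p ε, ∀ w ∈ ball p ε,
      ‖A w - A v - fderiv ℝ A v (w - v)‖ ≤ C * ‖w - v‖ ^ 2 := by
    intro v hv w hw
    have hseg : segment ℝ v w ⊆ ball p ε := (convex_ball p ε).segment_subset hv hw
    have h := (convex_segment v w).norm_image_sub_le_of_norm_hasFDerivWithin_le'
      (f := A) (f' := fderiv ℝ A) (φ := fderiv ℝ A v) (C := C * ‖w - v‖)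
      (fun z hz => (hd z (hseg hz)).hasFDerivAt.hasFDerivWithinAt) (fun z hz => by
        have := hK₂.dist_le_mul z (hδs (hεs (hseg hz))).1.2 v (hδs (hεs hv)).1.2
        rw [dist_eq_norm, dist_eq_norm] at this
        refine this.trans ?_
        gcongr
        · exact (le_max_right _ _).trans (le_max_right _ _)
        · exact norm_sub_le_of_mem_segment hz) (left_mem_segment ℝ v w) (right_mem_segment ℝ v w)
    refine h.trans (le_of_eq (by ring))
  have hex : ∀ u ∈ ball p ε, ∃ Y : ℝ → R, Y 0 = 1 ∧ ∀ t ∈ Icc (0 : ℝ) 1,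
      HasDerivWithinAt Y (A (p + t • (u - p)) (u - p) * Y t) (Icc 0 1) t := fun u hu =>
    exists_radial_solution hCpos.le hεC (fun v hv => (hd v hv).continuousAt.continuousWithinAt)
      hAC hu
  choose! Y hY0 hY using hex
  have hp1 : Y p 1 = 1 := by
    have h := norm_le_of_norm_deriv_le_add (f := fun t => Y p t - 1) le_rfl
      (fun t ht => (hY p (mem_ball_self hε) t ht).sub_const 1) (by simp [hY0 p (mem_ball_self hε)])
      (fun t ht => by simp) 1 (by simp)
    rw [mul_zero] at h
    exact sub_eq_zero.1 (norm_le_zero_iff.1 h)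
  exact ⟨ε, hε, hεΩ, fun u => Y u 1, hp1, fun u hu =>
    solvesAt_of_radial_solution hCpos.le hεC ((min_le_right _ _).trans (min_le_left _ _)) hd hAC
      hlip htay (fun v hv => hflat v (hεΩ hv)) hY0 hY hu⟩

end TotalDifferential

/-! ### Sections of local systems over a simply connected space. -/

/-- The bundle with discrete fibre glued from the fibrewise identifications `T i`, whose
transition functions are locally constant. -/
def flatBundleCore {X F : Type*} [TopologicalSpace X] [TopologicalSpace F] [DiscreteTopology F]
    (U : X → Set X) (hU : ∀ i, IsOpen (U i)) (hxU : ∀ x, x ∈ U x) (T : X → X → F ≃ F)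
    (hT : ∀ i j, ∀ x ∈ U i ∩ U j, ∀ᶠ y in 𝓝 x, ∀ v,
      (T j y).symm (T i y v) = (T j x).symm (T i x v)) : FiberBundleCore X X F where
  baseSet := U
  isOpen_baseSet := hU
  indexAt := id
  mem_baseSet_at := hxU
  coordChange i j x v := (T j x).symm (T i x v)
  coordChange_self i x _ v := by simp
  continuousOn_coordChange i j := by
    rintro ⟨x, v⟩ hx
    refine ContinuousAt.continuousWithinAt ?_
    refine continuousAt_const.congr (f := fun _ => (T j x).symm (T i x v)) ?_
    have h1 : ∀ᶠ q : X × F in 𝓝 (x, v), ∀ v, (T j q.1).symm (T i q.1 v) = (T j x).symm (T i x v) :=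
      (continuousAt_fst : ContinuousAt Prod.fst (x, v)).eventually (hT i j x hx.1)
    have h2 : ∀ᶠ q : X × F in 𝓝 (x, v), q.2 = v :=
      (continuousAt_snd : ContinuousAt Prod.snd (x, v)).eventually
        (eventually_of_mem ((isOpen_discrete {v}).mem_nhds rfl) fun _ => id)
    filter_upwards [h1, h2] with q hq hq2
    rw [hq, hq2]
  coordChange_comp i j k x _ v := by simp

/-- Over a simply connected space, a local system has a global section through any point. -/
theorem exists_section_of_locally_constant_transition {X F : Type*} [TopologicalSpace X]
    [SimplyConnectedSpace X] [LocallyPathConnectedSpace X]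
    (U : X → Set X) (hU : ∀ i, IsOpen (U i)) (hxU : ∀ x, x ∈ U x) (T : X → X → F ≃ F)
    (hT : ∀ i j, ∀ x ∈ U i ∩ U j, ∀ᶠ y in 𝓝 x, ∀ v,
      (T j y).symm (T i y v) = (T j x).symm (T i x v)) (p : X) (v₀ : F) :
    ∃ s : X → F, s p = v₀ ∧ ∀ x, ∀ᶠ y in 𝓝 x, (T x y).symm (s y) = (T x x).symm (s x) := by
  -- With a discrete fibre the bundle projection is a covering map, so the identity of the simply
  -- connected base lifts, which is a global section.
  let _ : TopologicalSpace F := ⊥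
  have : DiscreteTopology F := ⟨rfl⟩
  let Z := flatBundleCore U hU hxU T hT
  have hcov : IsCoveringMap (Bundle.TotalSpace.proj : Bundle.TotalSpace F Z.Fiber → X) :=
    FiberBundle.isCoveringMap
  obtain ⟨σ, ⟨hσ0, hσ⟩, -⟩ := hcov.existsUnique_continuousMap_lifts (ContinuousMap.id X) p
    ⟨p, (T p p).symm v₀⟩ rfl
  have hσ' : ∀ x, (σ x).1 = x := fun x => congrFun hσ x
  let val : Bundle.TotalSpace F Z.Fiber → F := fun z => z.2
  -- A point of the bundle over x is stored as its coordinate in the chart indexed by x itself; `T x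
  -- x` turns it into the actual value.
  refine ⟨fun x => T x x (val (σ x)), ?_, fun x => ?_⟩
  · change T p p (val (σ p)) = v₀
    rw [hσ0]
    exact (T p p).apply_symm_apply v₀
  have hx : σ x ∈ (Z.localTriv x).source := by
    rw [Z.mem_localTriv_source, hσ']
    exact hxU x
  have hc : ContinuousAt (fun y => ((Z.localTriv x) (σ y)).2) x :=
    continuousAt_snd.comp
      (ContinuousAt.comp ((Z.localTriv x).toOpenPartialHomeomorph.continuousAt hx)
        σ.continuous.continuousAt)
  have hev := hc.eventually (eventually_of_mem
    ((isOpen_discrete {((Z.localTriv x) (σ x)).2}).mem_nhds rfl) fun _ => id)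
  filter_upwards [hev] with y hy
  have hval : ∀ y, ((Z.localTriv x) (σ y)).2 = (T x y).symm (T y y (val (σ y))) := fun y => by
    rw [Z.localTriv_apply]
    change (T x (σ y).1).symm (T (σ y).1 (σ y).1 (val (σ y))) = _
    rw [hσ']
  rw [← hval, ← hval]
  exact hy

/-! ### Global solvability on a simply connected domain. -/

section TotalDifferential

variable {M R : Type*} [NormedAddCommGroup M] [NormedSpace ℝ M]
  [NormedRing R] [NormedAlgebra ℝ R]

theorem SolvesAt.mul_const {A : M → M →L[ℝ] R} {G : M → R} {u : M} (h : SolvesAt A G u) (c : R) :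
    SolvesAt A (fun v => G v * c) u := by
  have h1 := (((ContinuousLinearMap.mul ℝ R).flip c).hasFDerivAt (x := G u)).comp u h
  refine h1.congr_fderiv ?_
  ext a
  simp [mul_assoc]

theorem SolvesAt.congr {A : M → M →L[ℝ] R} {G G' : M → R} {u : M} (h : SolvesAt A G u)
    (hG : G' =ᶠ[𝓝 u] G) : SolvesAt A G' u := by
  have h1 := h.congr_of_eventuallyEq hG
  rw [← hG.eq_of_nhds] at h1
  exact h1

/-- Two solutions, one of them invertible, differ locally by a constant factor. -/
theorem SolvesAt.hasFDerivAt_inv_mul [CompleteSpace R] {A : M → M →L[ℝ] R} {G H : M → R} {u : M}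
    (hG : SolvesAt A G u) (hH : SolvesAt A H u) (hu : IsUnit (G u)) :
    HasFDerivAt (fun v => Ring.inverse (G v) * H v) (0 : M →L[ℝ] R) u := by
  obtain ⟨x, hx⟩ := hu
  have h0 := hasFDerivAt_ringInverse (𝕜 := ℝ) x
  rw [hx] at h0
  have h1 := h0.comp u hG
  refine (h1.mul' hH).congr_fderiv ?_
  ext a
  simp [← hx, mul_assoc]

theorem SolvesAt.differentiableAt {A : M → M →L[ℝ] R} {G : M → R} {u : M} (h : SolvesAt A G u) :
    DifferentiableAt ℝ G u := HasFDerivAt.differentiableAt h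

/-- Bootstrapping: the derivative of G is the product of A and G, hence as regular as G, so each
degree of smoothness yields the next. -/
theorem contDiffOn_of_solvesAt {A : M → M →L[ℝ] R} {Ω : Set M} (hΩ : IsOpen Ω) {G : M → R}
    (hA : ContDiffOn ℝ ∞ A Ω) (hG : ∀ u ∈ Ω, SolvesAt A G u) : ContDiffOn ℝ ∞ G Ω := by
  rw [contDiffOn_infty]
  intro n
  induction n with
  | zero =>
    exact contDiffOn_zero.2 fun u hu => (hG u hu).differentiableAt.continuousAt.continuousWithinAt
  | succ n ih =>
    have : ((n + 1 : ℕ) : WithTop ℕ∞) = (n : WithTop ℕ∞) + 1 := by push_cast; rfl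
    rw [this, contDiffOn_succ_iff_fderiv_of_isOpen hΩ]
    refine ⟨fun u hu => (hG u hu).differentiableAt.differentiableWithinAt, by simp, ?_⟩
    refine ContDiffOn.congr (f := fun u => (ContinuousLinearMap.mul ℝ R).flip (G u) ∘L A u) ?_
      fun u hu => HasFDerivAt.fderiv (hG u hu)
    exact (((ContinuousLinearMap.mul ℝ R).flip.contDiff).comp_contDiffOn ih).clm_comp
      (hA.of_le (by exact_mod_cast le_top))

/-- A flat linear total differential system on a simply connected domain has a global solution. -/
theorem exists_global_solution [CompleteSpace R] {A : M → M →L[ℝ] R} {Ω : Set M} (hΩ : IsOpen Ω)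
    (hsc : IsSimplyConnected Ω) (hA : ContDiffOn ℝ ∞ A Ω) (hflat : IsFlatForm A Ω) {p : M}
    (hp : p ∈ Ω) : ∃ G : M → R, G p = 1 ∧ ContDiffOn ℝ ∞ G Ω ∧ ∀ u ∈ Ω, SolvesAt A G u := by
  classical
  have := hsc.simplyConnectedSpace
  have := hΩ.locallyPathConnectedSpace
  have hloc : ∀ x : Ω, ∃ U : Set M, IsOpen U ∧ x.1 ∈ U ∧ ∃ G : M → R,
      ∀ u ∈ U, SolvesAt A G u ∧ IsUnit (G u) := by
    intro x
    obtain ⟨ε, hε, hsub, G, hG1, hG⟩ :=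
      exists_local_solution hΩ (contDiffOn_infty.1 hA 2) hflat x.2
    have hc : ContinuousAt G x := (hG x (mem_ball_self hε)).differentiableAt.continuousAt
    have hunit : ∀ᶠ u in 𝓝 (x : M), IsUnit (G u) :=
      hc.eventually (Units.isOpen.mem_nhds (by rw [mem_ofPred_eq, hG1]; exact isUnit_one))
    obtain ⟨U, hUs, hUo, hxU⟩ := _root_.mem_nhds_iff.1
      (inter_mem hunit (isOpen_ball.mem_nhds (mem_ball_self hε)))
    exact ⟨U, hUo, hxU, G, fun u hu => ⟨hG u (hUs hu).2, (hUs hu).1⟩⟩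
  choose U hUo hxU G hG using hloc
  let g : Ω → Ω → Rˣ := fun i x => if h : IsUnit (G i x) then h.unit else 1
  have hg : ∀ i x : Ω, (x : M) ∈ U i → (g i x : R) = G i x := fun i x hx => by
    have h := (hG i x hx).2
    simp [g, h]
  let T : Ω → Ω → R ≃ R := fun i x => Units.mulLeft (g i x)
  have hTs : ∀ i x : Ω, (x : M) ∈ U i → ∀ v, (T i x).symm v = Ring.inverse (G i x) * v := by
    intro i x hx v
    rw [← hg i x hx, Ring.inverse_unit]
    rfl
  have hTa : ∀ i x : Ω, (x : M) ∈ U i → ∀ v, T i x v = G i x * v := by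
    intro i x hx v
    rw [← hg i x hx]
    rfl
  -- The left quotient of two solutions has zero derivative. This is what makes the local solutions
  -- a local system.
  have hconst : ∀ i j x : Ω, (x : M) ∈ U i → (x : M) ∈ U j → ∀ᶠ y : Ω in 𝓝 x,
      Ring.inverse (G j y) * G i y = Ring.inverse (G j x) * G i x := by
    intro i j x hi hj
    obtain ⟨r, hr, hrs⟩ := Metric.mem_nhds_iff.1 (((hUo i).inter (hUo j)).mem_nhds ⟨hi, hj⟩)
    have hev : ∀ᶠ y : Ω in 𝓝 x, (y : M) ∈ ball (x : M) r :=
      continuous_subtype_val.continuousAt.eventually (ball_mem_nhds _ hr)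
    filter_upwards [hev] with y hy
    refine (convex_ball (x : M) r).is_const_of_fderivWithin_eq_zero (𝕜 := ℝ)
      (f := fun y => Ring.inverse (G j y) * G i y) ?_ ?_ hy (mem_ball_self hr)
    · exact fun z hz => ((hG j z (hrs hz).2).1.hasFDerivAt_inv_mul (hG i z (hrs hz).1).1
        (hG j z (hrs hz).2).2).differentiableAt.differentiableWithinAt
    · intro z hz
      rw [fderivWithin_of_isOpen isOpen_ball hz]
      exact ((hG j z (hrs hz).2).1.hasFDerivAt_inv_mul (hG i z (hrs hz).1).1
        (hG j z (hrs hz).2).2).fderiv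
  obtain ⟨s, hsp, hs⟩ := exists_section_of_locally_constant_transition
    (fun i : Ω => ((↑) : Ω → M) ⁻¹' U i) (fun i => (hUo i).preimage continuous_subtype_val) hxU T
    (fun i j x hx => by
      have h1 : ∀ᶠ y : Ω in 𝓝 x, (y : M) ∈ U i ∩ U j :=
        continuous_subtype_val.continuousAt.eventually (((hUo i).inter (hUo j)).mem_nhds hx)
      filter_upwards [hconst i j x hx.1 hx.2, h1] with y hy hyU v
      rw [hTs j y hyU.2, hTs j x hx.2, hTa i y hyU.1, hTa i x hx.1, ← mul_assoc, ← mul_assoc, hy])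
    ⟨p, hp⟩ 1
  let S : M → R := fun u => if h : u ∈ Ω then s ⟨u, h⟩ else 0
  have hS : ∀ u ∈ Ω, SolvesAt A S u := by
    intro u hu
    have h1 : ∀ᶠ y : Ω in 𝓝 (⟨u, hu⟩ : Ω), S y =
        G ⟨u, hu⟩ y * (T ⟨u, hu⟩ ⟨u, hu⟩).symm (s ⟨u, hu⟩) := by
      have h2 : ∀ᶠ y : Ω in 𝓝 (⟨u, hu⟩ : Ω), (y : M) ∈ U ⟨u, hu⟩ :=
        continuous_subtype_val.continuousAt.eventually ((hUo _).mem_nhds (hxU _))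
      filter_upwards [hs ⟨u, hu⟩, h2] with y hy hyU
      rw [← hTa _ _ hyU, ← hy]
      simp [S]
    rw [nhds_subtype_eq_comap, eventually_comap] at h1
    have h3 : S =ᶠ[𝓝 u] fun y => G ⟨u, hu⟩ y * (T ⟨u, hu⟩ ⟨u, hu⟩).symm (s ⟨u, hu⟩) := by
      filter_upwards [h1, hΩ.mem_nhds hu] with y hy hyΩ
      exact hy ⟨y, hyΩ⟩ rfl
    exact ((hG ⟨u, hu⟩ u (hxU ⟨u, hu⟩)).1.mul_const _).congr h3
  exact ⟨S, by simp [S, hp, hsp], contDiffOn_of_solvesAt hΩ hA hS, hS⟩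

end TotalDifferential

/-! ### Partial derivatives. -/

section PartialDerivatives

variable {N : ℕ} {E : Type*} [NormedAddCommGroup E] [NormedSpace ℝ E]

theorem fderiv_eq_sum_pd (f : (Fin N → ℝ) → E) (u a : Fin N → ℝ) :
    fderiv ℝ f u a = ∑ i, a i • pd i f u := by
  conv_lhs => rw [← Finset.univ_sum_single a, map_sum]
  refine Finset.sum_congr rfl fun i _ => ?_
  rw [pd, ← map_smul, ← Pi.single_smul', smul_eq_mul, mul_one]

theorem _root_.HasFDerivAt.pd_eq {f : (Fin N → ℝ) → E} {f' : (Fin N → ℝ) →L[ℝ] E}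
    {u : Fin N → ℝ} (h : HasFDerivAt f f' u) (i : Fin N) : pd i f u = f' (Pi.single i 1) := by
  rw [pd, h.fderiv]

theorem contDiffOn_pd {f : (Fin N → ℝ) → E} {Ω : Set (Fin N → ℝ)} (hΩ : IsOpen Ω)
    (hf : ContDiffOn ℝ ∞ f Ω) (i : Fin N) : ContDiffOn ℝ ∞ (pd i f) Ω :=
  (hf.fderiv_of_isOpen hΩ (by simp)).clm_apply contDiffOn_const

theorem differentiableAt_of_contDiffOn {f : (Fin N → ℝ) → E} {Ω : Set (Fin N → ℝ)} (hΩ : IsOpen Ω)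
    (hf : ContDiffOn ℝ ∞ f Ω) {u : Fin N → ℝ} (hu : u ∈ Ω) : DifferentiableAt ℝ f u :=
  (hf.contDiffAt (hΩ.mem_nhds hu)).differentiableAt (by simp)

theorem pd_congr {f g : (Fin N → ℝ) → E} {Ω : Set (Fin N → ℝ)} (hΩ : IsOpen Ω)
    (h : ∀ u ∈ Ω, f u = g u) {u : Fin N → ℝ} (hu : u ∈ Ω) (i : Fin N) : pd i f u = pd i g u := by
  rw [pd, pd, Filter.EventuallyEq.fderiv_eq (eventually_of_mem (hΩ.mem_nhds hu) h)]

theorem pd_comm {f : (Fin N → ℝ) → E} {Ω : Set (Fin N → ℝ)} (hΩ : IsOpen Ω)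
    (hf : ContDiffOn ℝ ∞ f Ω) {u : Fin N → ℝ} (hu : u ∈ Ω) (i j : Fin N) :
    pd i (pd j f) u = pd j (pd i f) u := by
  have h2 : ContDiffAt ℝ 2 f u := (contDiffOn_infty.1 hf 2).contDiffAt (hΩ.mem_nhds hu)
  have hd : DifferentiableAt ℝ (fderiv ℝ f) u :=
    (h2.fderiv_right (m := 1) (by norm_num)).differentiableAt one_ne_zero
  have key : ∀ i j : Fin N,
      pd i (pd j f) u = fderiv ℝ (fderiv ℝ f) u (Pi.single i 1) (Pi.single j 1) := fun i j => by
    have h := (hd.hasFDerivAt.clm_apply (hasFDerivAt_const (Pi.single j (1 : ℝ)) u)).pd_eq i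
    change pd i (fun y => fderiv ℝ f y (Pi.single j 1)) u = _
    rw [h]
    simp
  rw [key, key]
  exact h2.isSymmSndFDerivAt (by simp) _ _

/-- A function with vanishing partial derivatives on a connected open set is constant there. -/
theorem eq_of_pd_eq_zero {f : (Fin N → ℝ) → E} {Ω : Set (Fin N → ℝ)} (hΩ : IsOpen Ω)
    (hc : IsPreconnected Ω) (hf : ∀ u ∈ Ω, DifferentiableAt ℝ f u)
    (h : ∀ u ∈ Ω, ∀ i, pd i f u = 0) {u v : Fin N → ℝ} (hu : u ∈ Ω) (hv : v ∈ Ω) : f u = f v := by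
  refine hΩ.is_const_of_fderiv_eq_zero (𝕜 := ℝ) hc
    (fun u hu => (hf u hu).differentiableWithinAt) (fun u hu => ?_) hu hv
  ext a
  rw [fderiv_eq_sum_pd]
  simp [h u hu]

end PartialDerivatives

/-! ### The Frobenius theorem for matrix systems ∂ⱼX = AⱼX. -/

section MatrixSystem

variable {N : ℕ} {S : Type*} [Fintype S] {R : Type*} [NormedRing R] [NormedAlgebra ℝ R]

/-- The connection form `∑ⱼ Aⱼ duʲ` of a matrix-valued system, where `E s t` are the matrix units
of an algebra `R`. -/
noncomputable def connectionForm (E : S → S → R) (A : Fin N → (Fin N → ℝ) → S → S → ℝ)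
    (u : Fin N → ℝ) : (Fin N → ℝ) →L[ℝ] R :=
  ∑ j, ∑ s, ∑ t, A j u s t •
    (ContinuousLinearMap.proj (R := ℝ) (φ := fun _ : Fin N => ℝ) j).smulRight (E s t)

theorem connectionForm_apply (E : S → S → R) (A : Fin N → (Fin N → ℝ) → S → S → ℝ)
    (u h : Fin N → ℝ) : connectionForm E A u h = ∑ j, h j • ∑ s, ∑ t, A j u s t • E s t := by
  simp only [connectionForm, sum_apply, smul_apply, ContinuousLinearMap.smulRight_apply,
    ContinuousLinearMap.proj_apply, Finset.smul_sum]
  exact Finset.sum_congr rfl fun j _ => Finset.sum_congr rfl fun s _ =>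
    Finset.sum_congr rfl fun t _ => smul_comm _ _ _

theorem contDiffOn_connectionForm (E : S → S → R) {A : Fin N → (Fin N → ℝ) → S → S → ℝ}
    {Ω : Set (Fin N → ℝ)} (hA : ∀ j s t, ContDiffOn ℝ ∞ (fun u => A j u s t) Ω) :
    ContDiffOn ℝ ∞ (connectionForm E A) Ω :=
  ContDiffOn.sum fun j _ => ContDiffOn.sum fun s _ => ContDiffOn.sum fun t _ =>
    (hA j s t).smul contDiffOn_const

theorem pd_connectionForm (E : S → S → R) {A : Fin N → (Fin N → ℝ) → S → S → ℝ} {u : Fin N → ℝ}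
    (hA : ∀ j s t, DifferentiableAt ℝ (fun u => A j u s t) u) (i : Fin N) :
    pd i (connectionForm E A) u =
      connectionForm E (fun j v s t => pd i (fun v => A j v s t) v) u := by
  have hd : HasFDerivAt (connectionForm E A) (∑ j, ∑ s, ∑ t,
      (fderiv ℝ (fun v => A j v s t) u).smulRight
        ((ContinuousLinearMap.proj (R := ℝ) (φ := fun _ : Fin N => ℝ) j).smulRight (E s t))) u :=
    HasFDerivAt.fun_sum fun j _ => HasFDerivAt.fun_sum fun s _ => HasFDerivAt.fun_sum fun t _ =>
      (hA j s t).hasFDerivAt.smul_const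
        ((ContinuousLinearMap.proj (R := ℝ) (φ := fun _ : Fin N => ℝ) j).smulRight (E s t))
  rw [hd.pd_eq]
  simp only [sum_apply, ContinuousLinearMap.smulRight_apply, connectionForm, pd]

theorem matrixUnits_sum_mul [DecidableEq S] {E : S → S → R}
    (hE : ∀ s t s' t', E s t * E s' t' = if t = s' then E s t' else 0) (B C : S → S → ℝ) :
    (∑ s, ∑ t, B s t • E s t) * (∑ s, ∑ t, C s t • E s t) =
      ∑ s, ∑ t, (∑ q, B s q * C q t) • E s t := by
  simp only [Finset.sum_mul_sum, smul_mul_smul_comm, hE, smul_ite, smul_zero, Finset.sum_smul]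
  refine Finset.sum_congr rfl fun s _ => ?_
  rw [Finset.sum_comm]
  conv_lhs => enter [2, t]; rw [Finset.sum_comm]
  rw [Finset.sum_comm]
  simp

/-- Since ∂ᵢ(AⱼX) = (∂ᵢAⱼ + AⱼAᵢ)X, the entrywise condition is the equality of mixed second
derivatives. Expanding both vectors in coordinates reduces the abstract condition to it. -/
theorem isFlatForm_connectionForm [DecidableEq S] {E : S → S → R}
    (hE : ∀ s t s' t', E s t * E s' t' = if t = s' then E s t' else 0)
    {A : Fin N → (Fin N → ℝ) → S → S → ℝ} {Ω : Set (Fin N → ℝ)}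
    (hA : ∀ u ∈ Ω, ∀ j s t, DifferentiableAt ℝ (fun u => A j u s t) u)
    (hint : ∀ u ∈ Ω, ∀ i j s t, pd i (fun v => A j v s t) u + ∑ q, A j u s q * A i u q t =
      pd j (fun v => A i v s t) u + ∑ q, A i u s q * A j u q t) :
    IsFlatForm (connectionForm E A) Ω := by
  intro u hu a b
  have key : ∀ a b : Fin N → ℝ, fderiv ℝ (connectionForm E A) u a b +
      connectionForm E A u b * connectionForm E A u a = ∑ i, ∑ j, (a i * b j) •
        ∑ s, ∑ t, (pd i (fun v => A j v s t) u + ∑ q, A j u s q * A i u q t) • E s t := by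
    intro a b
    rw [fderiv_eq_sum_pd, sum_apply]
    simp only [smul_apply, pd_connectionForm E (hA u hu), connectionForm_apply, add_smul,
      Finset.sum_add_distrib, smul_add]
    congr 1
    · simp only [Finset.smul_sum, smul_smul, mul_assoc]
    · rw [Finset.sum_mul_sum, Finset.sum_comm]
      refine Finset.sum_congr rfl fun i _ => Finset.sum_congr rfl fun j _ => ?_
      rw [smul_mul_smul_comm, mul_comm (a i), matrixUnits_sum_mul hE]
  rw [key, key, Finset.sum_comm]
  refine Finset.sum_congr rfl fun i _ => Finset.sum_congr rfl fun j _ => ?_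
  rw [mul_comm]
  simp only [hint u hu]

/-- Only the multiplication table of the matrix units and the entry functionals enter, so any
complete normed algebra carrying them will do. -/
theorem exists_matrix_solution [DecidableEq S] [CompleteSpace R] {E : S → S → R}
    (hE : ∀ s t s' t', E s t * E s' t' = if t = s' then E s t' else 0)
    (ent : S → S → R →L[ℝ] ℝ) (hent : ∀ s t s' t' g,
      ent s t (E s' t' * g) = if s = s' then ent t' t g else 0)
    (hone : ∀ s t, ent s t 1 = if s = t then 1 else 0)
    {A : Fin N → (Fin N → ℝ) → S → S → ℝ} {Ω : Set (Fin N → ℝ)} (hΩ : IsOpen Ω)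
    (hsc : IsSimplyConnected Ω) (hA : ∀ j s t, ContDiffOn ℝ ∞ (fun u => A j u s t) Ω)
    (hint : ∀ u ∈ Ω, ∀ i j s t, pd i (fun v => A j v s t) u + ∑ q, A j u s q * A i u q t =
      pd j (fun v => A i v s t) u + ∑ q, A i u s q * A j u q t)
    {p : Fin N → ℝ} (hp : p ∈ Ω) :
    ∃ X : S → S → (Fin N → ℝ) → ℝ, (∀ s t, X s t p = if s = t then 1 else 0) ∧
      (∀ s t, ContDiffOn ℝ ∞ (X s t) Ω) ∧
      ∀ u ∈ Ω, ∀ j s t, pd j (X s t) u = ∑ q, A j u s q * X q t u := by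
  obtain ⟨G, hG1, hGs, hG⟩ := exists_global_solution hΩ hsc (contDiffOn_connectionForm E hA)
    (isFlatForm_connectionForm hE
      (fun u hu j s t => differentiableAt_of_contDiffOn hΩ (hA j s t) hu) hint) hp
  refine ⟨fun s t u => ent s t (G u), fun s t => by simp only [hG1, hone],
    fun s t => (ent s t).contDiff.comp_contDiffOn hGs, fun u hu j s t => ?_⟩
  have hd := (ent s t).hasFDerivAt.comp u (hG u hu)
  have hd' : HasFDerivAt (fun u => ent s t (G u)) _ u := hd
  rw [hd'.pd_eq]
  simp [connectionForm_apply, Pi.single_apply, hent, ite_smul]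

/-- Frobenius theorem for linear systems: a flat system `∂ⱼ X = Aⱼ X` on a simply connected domain
has a solution with any initial value. -/
theorem exists_frame [DecidableEq S] {V : Type*} [NormedAddCommGroup V] [NormedSpace ℝ V]
    {A : Fin N → (Fin N → ℝ) → S → S → ℝ} {Ω : Set (Fin N → ℝ)} (hΩ : IsOpen Ω)
    (hsc : IsSimplyConnected Ω) (hA : ∀ j s t, ContDiffOn ℝ ∞ (fun u => A j u s t) Ω)
    (hint : ∀ u ∈ Ω, ∀ i j s t, pd i (fun v => A j v s t) u + ∑ q, A j u s q * A i u q t =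
      pd j (fun v => A i v s t) u + ∑ q, A i u s q * A j u q t)
    {p : Fin N → ℝ} (hp : p ∈ Ω) (X₀ : S → V) :
    ∃ X : S → (Fin N → ℝ) → V, (∀ s, X s p = X₀ s) ∧ (∀ s, ContDiffOn ℝ ∞ (X s) Ω) ∧
      ∀ u ∈ Ω, ∀ j s, pd j (X s) u = ∑ t, A j u s t • X t u := by
  -- The algebra is that of endomorphisms of ℝ^S with the operator norm, and the unit E s t is the
  -- rank one map x ↦ x_t e_s.
  obtain ⟨X, hX0, hXs, hX⟩ := exists_matrix_solution (R := (S → ℝ) →L[ℝ] (S → ℝ))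
    (E := fun s t => (ContinuousLinearMap.proj (R := ℝ) (φ := fun _ : S => ℝ) t).smulRight
      (Pi.single s (1 : ℝ)))
    (by
      intro s t s' t'
      ext1 x
      by_cases h : t = s' <;> simp [h])
    (fun s t => ContinuousLinearMap.proj (R := ℝ) (φ := fun _ : S => ℝ) s ∘L
      ContinuousLinearMap.apply ℝ (S → ℝ) (Pi.single t (1 : ℝ)))
    (by
      intro s t s' t' g
      by_cases h : s = s' <;> simp [h])
    (by
      intro s t
      simp [Pi.single_apply]) hΩ hsc hA hint hp
  refine ⟨fun s u => ∑ t, X s t u • X₀ t, fun s => ?_, fun s => ?_, fun u hu j s => ?_⟩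
  · simp [hX0]
  · exact ContDiffOn.sum fun t _ => (hXs s t).smul contDiffOn_const
  · have hd : HasFDerivAt (fun u => ∑ t, X s t u • X₀ t) _ u :=
      HasFDerivAt.fun_sum fun t _ =>
        ((differentiableAt_of_contDiffOn hΩ (hXs s t) hu).hasFDerivAt.smul_const (X₀ t))
    rw [hd.pd_eq]
    simp only [sum_apply, ContinuousLinearMap.smulRight_apply]
    change ∑ t, pd j (X s t) u • X₀ t = _
    simp only [hX u hu, Finset.sum_smul, Finset.smul_sum, smul_smul]
    exact Finset.sum_comm

/-- A flat linear system whose solution consists of the gradients of functions `r`. -/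
theorem exists_frame_and_primitive [DecidableEq S] {V : Type*} [NormedAddCommGroup V]
    [NormedSpace ℝ V]
    {A : Fin N → (Fin N → ℝ) → S → S → ℝ} {Ω : Set (Fin N → ℝ)} (hΩ : IsOpen Ω)
    (hsc : IsSimplyConnected Ω) (hA : ∀ j s t, ContDiffOn ℝ ∞ (fun u => A j u s t) Ω)
    (hint : ∀ u ∈ Ω, ∀ i j s t, pd i (fun v => A j v s t) u + ∑ q, A j u s q * A i u q t =
      pd j (fun v => A i v s t) u + ∑ q, A i u s q * A j u q t)
    (σ : Fin N → S) (hσ : ∀ u ∈ Ω, ∀ i j t, A i u (σ j) t = A j u (σ i) t)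
    {p : Fin N → ℝ} (hp : p ∈ Ω) (X₀ : S → V) :
    ∃ (r : (Fin N → ℝ) → V) (X : S → (Fin N → ℝ) → V), (∀ s, X s p = X₀ s) ∧
      ContDiffOn ℝ ∞ r Ω ∧ (∀ s, ContDiffOn ℝ ∞ (X s) Ω) ∧
      (∀ u ∈ Ω, ∀ j, pd j r u = X (σ j) u) ∧
      ∀ u ∈ Ω, ∀ j s, pd j (X s) u = ∑ t, A j u s t • X t u := by
  -- One more unknown r is adjoined, with the equation ∂ⱼr = X_{σ j}. The enlarged system is flat
  -- exactly because the old one is and the rows σ j satisfy the symmetry `hσ`.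
  let A' : Fin N → (Fin N → ℝ) → Unit ⊕ S → Unit ⊕ S → ℝ := fun j u a b =>
    Sum.elim (fun _ => Sum.elim (fun _ => 0) (fun t => if t = σ j then 1 else 0) b)
      (fun s => Sum.elim (fun _ => 0) (fun t => A j u s t) b) a
  obtain ⟨X, hX0, hXs, hX⟩ := exists_frame (A := A') hΩ hsc
    (by
      rintro j (_ | s) (_ | t)
      exacts [contDiffOn_const, contDiffOn_const, contDiffOn_const, hA j s t])
    (by
      rintro u hu i j (_ | s) (_ | t)
      · simp [A', pd]
      · simp [A', pd, hσ u hu i j t]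
      · simp [A', pd]
      · simpa [A'] using hint u hu i j s t)
    hp (Sum.elim (fun _ => 0) X₀)
  refine ⟨X (Sum.inl ()), fun s => X (Sum.inr s), fun s => hX0 _, hXs _, fun s => hXs _,
    fun u hu j => ?_, fun u hu j s => ?_⟩
  · rw [hX u hu]
    simp [A', ite_smul]
  · rw [hX u hu]
    simp [A']

end MatrixSystem

/-! ### Rules of differentiation for partial derivatives and bilinear expressions. -/

section Calculus

variable {N : ℕ} {E : Type*} [NormedAddCommGroup E] [NormedSpace ℝ E] {u : Fin N → ℝ}

theorem pd_const (c : E) (i : Fin N) : pd i (fun _ : Fin N → ℝ => c) u = 0 := by simp [pd]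

theorem pd_add {f g : (Fin N → ℝ) → E} (hf : DifferentiableAt ℝ f u) (hg : DifferentiableAt ℝ g u)
    (i : Fin N) : pd i (fun v => f v + g v) u = pd i f u + pd i g u :=
  (hf.hasFDerivAt.add hg.hasFDerivAt).pd_eq i

theorem pd_sub {f g : (Fin N → ℝ) → E} (hf : DifferentiableAt ℝ f u) (hg : DifferentiableAt ℝ g u)
    (i : Fin N) : pd i (fun v => f v - g v) u = pd i f u - pd i g u :=
  (hf.hasFDerivAt.sub hg.hasFDerivAt).pd_eq i

theorem pd_sum {ι : Type*} [Fintype ι] {f : ι → (Fin N → ℝ) → E}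
    (hf : ∀ a, DifferentiableAt ℝ (f a) u) (i : Fin N) :
    pd i (fun v => ∑ a, f a v) u = ∑ a, pd i (f a) u := by
  rw [(HasFDerivAt.fun_sum fun a _ => (hf a).hasFDerivAt).pd_eq i, sum_apply]
  rfl

theorem pd_smul {f : (Fin N → ℝ) → ℝ} {g : (Fin N → ℝ) → E} (hf : DifferentiableAt ℝ f u)
    (hg : DifferentiableAt ℝ g u) (i : Fin N) :
    pd i (fun v => f v • g v) u = pd i f u • g u + f u • pd i g u := by
  rw [(hf.hasFDerivAt.fun_smul hg.hasFDerivAt).pd_eq i, add_comm]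
  rfl

theorem pd_mul {f g : (Fin N → ℝ) → ℝ} (hf : DifferentiableAt ℝ f u)
    (hg : DifferentiableAt ℝ g u) (i : Fin N) :
    pd i (fun v => f v * g v) u = pd i f u * g u + f u * pd i g u := pd_smul hf hg i

theorem pd_const_mul (c : ℝ) {g : (Fin N → ℝ) → ℝ} (hg : DifferentiableAt ℝ g u) (i : Fin N) :
    pd i (fun v => c * g v) u = c * pd i g u := by
  rw [pd_mul (differentiableAt_const c) hg, pd_const, zero_mul, zero_add]

theorem pd_linearMap {F : Type*} [NormedAddCommGroup F] [NormedSpace ℝ F] [FiniteDimensional ℝ E]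
    (L : E →ₗ[ℝ] F) {f : (Fin N → ℝ) → E} (hf : DifferentiableAt ℝ f u) (i : Fin N) :
    pd i (fun v => L (f v)) u = L (pd i f u) :=
  ((LinearMap.toContinuousLinearMap L).hasFDerivAt.comp u hf.hasFDerivAt).pd_eq i

theorem contDiffOn_linearMap {F : Type*} [NormedAddCommGroup F] [NormedSpace ℝ F]
    [FiniteDimensional ℝ E] (L : E →ₗ[ℝ] F) {f : (Fin N → ℝ) → E} {Ω : Set (Fin N → ℝ)}
    (hf : ContDiffOn ℝ ∞ f Ω) : ContDiffOn ℝ ∞ (fun v => L (f v)) Ω :=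
  (LinearMap.toContinuousLinearMap L).contDiff.comp_contDiffOn hf

theorem pd_coord (i j : Fin N) : pd i (fun v : Fin N → ℝ => v j) u = if i = j then 1 else 0 := by
  have h : HasFDerivAt (fun v : Fin N → ℝ => v j)
      (ContinuousLinearMap.proj (R := ℝ) (φ := fun _ : Fin N => ℝ) j) u :=
    hasFDerivAt_apply j u
  rw [h.pd_eq i]
  simp [Pi.single_apply, eq_comm]

end Calculus

section BilinearCalculus

variable {N : ℕ} {V : Type*} [NormedAddCommGroup V] [NormedSpace ℝ V] [FiniteDimensional ℝ V]
  (B : LinearMap.BilinForm ℝ V)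

theorem contDiffOn_bilin {f g : (Fin N → ℝ) → V} {Ω : Set (Fin N → ℝ)}
    (hf : ContDiffOn ℝ ∞ f Ω) (hg : ContDiffOn ℝ ∞ g Ω) :
    ContDiffOn ℝ ∞ (fun v => B (f v) (g v)) Ω :=
  (LinearMap.toContinuousBilinearMap B).isBoundedBilinearMap.contDiff.comp_contDiffOn (hf.prodMk hg)

theorem pd_bilin {f g : (Fin N → ℝ) → V} {u : Fin N → ℝ} (hf : DifferentiableAt ℝ f u)
    (hg : DifferentiableAt ℝ g u) (i : Fin N) :
    pd i (fun v => B (f v) (g v)) u = B (pd i f u) (g u) + B (f u) (pd i g u) := by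
  have h : HasFDerivAt (fun v => B (f v) (g v)) _ u :=
    (LinearMap.toContinuousBilinearMap B).hasFDerivAt_of_bilinear hf.hasFDerivAt hg.hasFDerivAt
  rw [h.pd_eq i, add_comm]
  rfl

theorem differentiableAt_bilin {f g : (Fin N → ℝ) → V} {u : Fin N → ℝ} (hf : DifferentiableAt ℝ f u)
    (hg : DifferentiableAt ℝ g u) : DifferentiableAt ℝ (fun v => B (f v) (g v)) u :=
  ((LinearMap.toContinuousBilinearMap B).hasFDerivAt_of_bilinear hf.hasFDerivAt
    hg.hasFDerivAt).differentiableAt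

/-- If `B (f, g)` is constant on an open set then `B (∂f, g) + B (f, ∂g) = 0`. -/
theorem bilin_pd_add_bilin_pd_eq_zero {f g : (Fin N → ℝ) → V} {Ω : Set (Fin N → ℝ)}
    (hΩ : IsOpen Ω) (hf : ContDiffOn ℝ ∞ f Ω) (hg : ContDiffOn ℝ ∞ g Ω) {c : ℝ}
    (h : ∀ u ∈ Ω, B (f u) (g u) = c) {u : Fin N → ℝ} (hu : u ∈ Ω) (i : Fin N) :
    B (pd i f u) (g u) + B (f u) (pd i g u) = 0 := by
  rw [← pd_bilin B (differentiableAt_of_contDiffOn hΩ hf hu)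
    (differentiableAt_of_contDiffOn hΩ hg hu), pd_congr hΩ h hu, pd_const]

end BilinearCalculus

/-! ### Bases and their Gram matrices. -/

section LinearAlgebra

variable {V S : Type*} [AddCommGroup V] [Module ℝ V] [Fintype S] [DecidableEq S]
  {B : LinearMap.BilinForm ℝ V} {X : S → V} {H : Matrix S S ℝ}

theorem linearIndependent_of_gram (hX : ∀ s t, B (X s) (X t) = H s t) (hH : H.det ≠ 0) :
    LinearIndependent ℝ X := by
  rw [Fintype.linearIndependent_iff]
  intro c hc
  have h : H.mulVec c = 0 := by
    ext s
    have := congrArg (B (X s)) hc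
    simp only [map_sum, map_smul, hX, map_zero, smul_eq_mul] at this
    simpa [Matrix.mulVec, dotProduct, mul_comm] using this
  exact congrFun (Matrix.eq_zero_of_mulVec_eq_zero hH h)

theorem expansion_of_gram [FiniteDimensional ℝ V] (hcard : Fintype.card S = Module.finrank ℝ V)
    (hX : ∀ s t, B (X s) (X t) = H s t) (hH : H.det ≠ 0) (v : V) :
    ∑ s, (∑ t, H⁻¹ s t * B (X t) v) • X s = v := by
  have hli := linearIndependent_of_gram hX hH
  have hv : v ∈ Submodule.span ℝ (Set.range X) := by
    rw [hli.span_eq_top_of_card_eq_finrank' hcard]; trivial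
  obtain ⟨c, rfl⟩ := (Submodule.mem_span_range_iff_exists_fun ℝ).1 hv
  refine Finset.sum_congr rfl fun s _ => ?_
  congr 1
  have h : H⁻¹.mulVec (H.mulVec c) = c := by
    rw [Matrix.mulVec_mulVec, Matrix.nonsing_inv_mul _ (isUnit_iff_ne_zero.2 hH), Matrix.one_mulVec]
  conv_rhs => rw [← h]
  simp only [Matrix.mulVec, dotProduct, map_sum, map_smul, hX, smul_eq_mul]
  simp only [mul_comm (c _)]

/-- Expanding X_q and comparing coefficients gives H⁻¹G = 1 for the true Gram matrix G; the
expansion shows that X spans, and the dimension then makes it independent. This turns a statement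
about the identity map of V into one about Gram matrices. -/
theorem gram_of_expansion [FiniteDimensional ℝ V] (hcard : Fintype.card S = Module.finrank ℝ V)
    (hH : H.det ≠ 0) (h : ∀ v, ∑ s, (∑ t, H⁻¹ s t * B (X t) v) • X s = v) (s t : S) :
    B (X s) (X t) = H s t := by
  have hspan : ⊤ ≤ Submodule.span ℝ (Set.range X) := fun v _ => by
    rw [← h v]
    exact Submodule.sum_mem _ fun s _ => Submodule.smul_mem _ _ (Submodule.subset_span ⟨s, rfl⟩)
  have hli := linearIndependent_of_top_le_span_of_card_eq_finrank hspan hcard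
  have hK : H⁻¹ * (Matrix.of fun s t => B (X s) (X t)) = 1 := by
    ext s q
    have h1 : ∑ s, ((∑ t, H⁻¹ s t * B (X t) (X q)) - if s = q then 1 else 0) • X s = 0 := by
      simp [sub_smul, h (X q)]
    have h2 := Fintype.linearIndependent_iff.1 hli _ h1 s
    rw [Matrix.mul_apply, Matrix.one_apply]
    exact sub_eq_zero.1 h2
  have h3 := congrArg (H * ·) hK
  simp only [← mul_assoc, Matrix.mul_nonsing_inv _ (isUnit_iff_ne_zero.2 hH), one_mul,
    mul_one] at h3
  exact congrFun (congrFun h3 s) t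

theorem det_gram_ne_zero [FiniteDimensional ℝ V] (hB : B.Nondegenerate)
    (hcard : Fintype.card S = Module.finrank ℝ V) (hli : LinearIndependent ℝ X)
    (hX : ∀ s t, B (X s) (X t) = H s t) : H.det ≠ 0 := by
  have hspan := (hli.span_eq_top_of_card_eq_finrank' hcard).ge
  let b : Module.Basis S ℝ V := Module.Basis.mk hli hspan
  have hm : LinearMap.BilinForm.toMatrix b B = H := by
    ext s t
    simp [LinearMap.BilinForm.toMatrix_apply, b, hX]
  rw [← hm]
  exact (LinearMap.BilinForm.nondegenerate_iff_det_ne_zero b).1 hB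

end LinearAlgebra

/-! ### Moving frames: constancy of the Gram matrix and rigidity. -/

section MovingFrame

variable {N : ℕ} {V : Type*} [NormedAddCommGroup V] [NormedSpace ℝ V] [FiniteDimensional ℝ V]
  {S : Type*} [Fintype S] {B : LinearMap.BilinForm ℝ V}

/-- `X` is a moving frame on `Ω` with dual Gram matrix `K` and connection coefficients
`D j u s t = (∂ⱼ X_s, X_t)`. -/
structure IsMovingFrame (K : Matrix S S ℝ) (D : Fin N → (Fin N → ℝ) → S → S → ℝ)
    (Ω : Set (Fin N → ℝ)) (X : S → (Fin N → ℝ) → V) : Prop where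
  smooth : ∀ s, ContDiffOn ℝ ∞ (X s) Ω
  deriv : ∀ u ∈ Ω, ∀ j s, pd j (X s) u = ∑ q, (∑ t, K q t * D j u s t) • X q u

/-- The map of `V` that transports the frame `X` into the frame `X'` does not depend on the point
if both frames have the same connection coefficients. -/
theorem IsMovingFrame.transport_eq {K : Matrix S S ℝ} (hK : K.IsSymm)
    {D : Fin N → (Fin N → ℝ) → S → S → ℝ} {Ω : Set (Fin N → ℝ)} (hΩ : IsOpen Ω)
    (hc : IsPreconnected Ω) (hD : ∀ u ∈ Ω, ∀ j s t, D j u s t = -D j u t s)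
    {X X' : S → (Fin N → ℝ) → V} (hX : IsMovingFrame K D Ω X) (hX' : IsMovingFrame K D Ω X')
    (v : V) {u p : Fin N → ℝ} (hu : u ∈ Ω) (hp : p ∈ Ω) :
    ∑ s, (∑ t, K s t * B (X t u) v) • X' s u = ∑ s, (∑ t, K s t * B (X t p) v) • X' s p := by
  have hdX : ∀ u ∈ Ω, ∀ s, DifferentiableAt ℝ (X s) u := fun u hu s =>
    differentiableAt_of_contDiffOn hΩ (hX.smooth s) hu
  have hdX' : ∀ u ∈ Ω, ∀ s, DifferentiableAt ℝ (X' s) u := fun u hu s =>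
    differentiableAt_of_contDiffOn hΩ (hX'.smooth s) hu
  have hdB : ∀ u ∈ Ω, ∀ t, DifferentiableAt ℝ (fun w => B (X t w) v) u := fun u hu t =>
    differentiableAt_bilin B (hdX u hu t) (differentiableAt_const v)
  have hds : ∀ u ∈ Ω, ∀ s, DifferentiableAt ℝ (fun w => ∑ t, K s t * B (X t w) v) u :=
    fun u hu s => DifferentiableAt.fun_sum fun t _ => (hdB u hu t).const_mul _
  refine eq_of_pd_eq_zero hΩ hc (f := fun w => ∑ s, (∑ t, K s t * B (X t w) v) • X' s w)
    (fun u hu => DifferentiableAt.fun_sum fun s _ => (hds u hu s).fun_smul (hdX' u hu s))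
    (fun u hu j => ?_) hu hp
  rw [pd_sum fun s => (hds u hu s).fun_smul (hdX' u hu s)]
  have h1 : ∀ s, pd j (fun w => ∑ t, K s t * B (X t w) v) u =
      ∑ t, K s t * ∑ q, (∑ m, K q m * D j u t m) * B (X q u) v := by
    intro s
    rw [pd_sum fun t => (hdB u hu t).const_mul _]
    refine Finset.sum_congr rfl fun t _ => ?_
    rw [pd_const_mul _ (hdB u hu t), pd_bilin B (hdX u hu t) (differentiableAt_const v), pd_const,
      map_zero, add_zero, hX.deriv u hu]
    simp only [map_sum, map_smul, LinearMap.sum_apply, LinearMap.smul_apply, smul_eq_mul]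
  have h2 : ∀ s, pd j (fun w => (∑ t, K s t * B (X t w) v) • X' s w) u =
      (∑ t, K s t * ∑ q, (∑ m, K q m * D j u t m) * B (X q u) v) • X' s u +
        (∑ t, K s t * B (X t u) v) • ∑ q, (∑ m, K q m * D j u s m) • X' q u := by
    intro s
    rw [pd_smul (hds u hu s) (hdX' u hu s), h1, hX'.deriv u hu]
  simp only [h2, Finset.sum_add_distrib]
  have h3 : ∑ s, (∑ t, K s t * B (X t u) v) • ∑ q, (∑ m, K q m * D j u s m) • X' q u =
      ∑ s, (∑ q, (∑ t, K q t * B (X t u) v) * ∑ m, K s m * D j u q m) • X' s u := by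
    simp only [Finset.smul_sum, smul_smul, Finset.sum_smul]
    rw [Finset.sum_comm]
    simp only [Finset.mul_sum, Finset.sum_smul]
  rw [h3, ← Finset.sum_add_distrib]
  -- The coefficient of X'_s is the s-th entry of K (D + Dᵀ) K applied to the vector (X_q, v), which
  -- vanishes because D is skew.
  refine Finset.sum_eq_zero fun s _ => ?_
  rw [← add_smul]
  convert zero_smul ℝ (X' s u)
  have h4 : ∑ t, K s t * ∑ q, (∑ m, K q m * D j u t m) * B (X q u) v =
      ∑ t, ∑ m, ∑ q, K s t * D j u t m * (K m q * B (X q u) v) := by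
    refine Finset.sum_congr rfl fun t _ => ?_
    simp only [Finset.mul_sum, Finset.sum_mul]
    rw [Finset.sum_comm]
    refine Finset.sum_congr rfl fun m _ => Finset.sum_congr rfl fun q _ => ?_
    rw [show K q m = K m q from hK.apply m q]
    ring
  have h5 : ∑ q, (∑ t, K q t * B (X t u) v) * ∑ m, K s m * D j u q m =
      ∑ m, ∑ q, ∑ t, K s m * D j u q m * (K q t * B (X t u) v) := by
    rw [Finset.sum_comm (f := fun m q => ∑ t, K s m * D j u q m * (K q t * B (X t u) v))]
    refine Finset.sum_congr rfl fun q _ => ?_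
    rw [Finset.sum_mul_sum, Finset.sum_comm]
    exact Finset.sum_congr rfl fun m _ => Finset.sum_congr rfl fun t _ => by ring
  rw [h4, h5, ← Finset.sum_add_distrib]
  refine Finset.sum_eq_zero fun t _ => ?_
  rw [← Finset.sum_add_distrib]
  refine Finset.sum_eq_zero fun m _ => ?_
  rw [← Finset.sum_add_distrib]
  refine Finset.sum_eq_zero fun q _ => ?_
  rw [hD u hu j t m]
  ring

/-- The Gram matrix of a moving frame is constant. -/
theorem IsMovingFrame.gram_eq [DecidableEq S] (hcard : Fintype.card S = Module.finrank ℝ V)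
    {H : Matrix S S ℝ} (hH : H.IsSymm) (hdet : H.det ≠ 0)
    {D : Fin N → (Fin N → ℝ) → S → S → ℝ} {Ω : Set (Fin N → ℝ)} (hΩ : IsOpen Ω)
    (hc : IsPreconnected Ω) (hD : ∀ u ∈ Ω, ∀ j s t, D j u s t = -D j u t s)
    {X : S → (Fin N → ℝ) → V} (hX : IsMovingFrame H⁻¹ D Ω X) {p : Fin N → ℝ} (hp : p ∈ Ω)
    (hXp : ∀ s t, B (X s p) (X t p) = H s t) {u : Fin N → ℝ} (hu : u ∈ Ω) (s t : S) :
    B (X s u) (X t u) = H s t := by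
  have hK : H⁻¹.IsSymm := by rw [Matrix.IsSymm, Matrix.transpose_nonsing_inv, hH]
  refine gram_of_expansion (X := fun s => X s u) hcard hdet (fun v => ?_) s t
  -- For X' = X the transport map at p is the identity, hence so it is at u.
  rw [hX.transport_eq hK hΩ hc hD hX v hu hp]
  exact expansion_of_gram (X := fun s => X s p) hcard hXp hdet v

omit [FiniteDimensional ℝ V] in
/-- The connection coefficients of a frame with Gram matrix `H`. -/
theorem bilin_pd_of_deriv [DecidableEq S] {H : Matrix S S ℝ} (hdet : H.det ≠ 0)
    {D : S → ℝ} {X : S → V} (hX : ∀ s t, B (X s) (X t) = H s t) {Y : V}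
    (hY : Y = ∑ q, (∑ t, H⁻¹ q t * D t) • X q) (t : S) : B (X t) Y = D t := by
  have h : H.mulVec (H⁻¹.mulVec D) = D := by
    rw [Matrix.mulVec_mulVec, Matrix.mul_nonsing_inv _ (isUnit_iff_ne_zero.2 hdet),
      Matrix.one_mulVec]
  conv_rhs => rw [← h]
  rw [hY]
  simp only [Matrix.mulVec, dotProduct, map_sum, map_smul, hX, smul_eq_mul]
  simp only [mul_comm (H t _)]

/-- Frames with the same Gram matrix and connection coefficients differ by an isometry. -/
theorem exists_isometry_of_frames [DecidableEq S] (hcard : Fintype.card S = Module.finrank ℝ V)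
    {H : Matrix S S ℝ} (hH : H.IsSymm) (hdet : H.det ≠ 0)
    {D : Fin N → (Fin N → ℝ) → S → S → ℝ} {Ω : Set (Fin N → ℝ)} (hΩ : IsOpen Ω)
    (hc : IsConnected Ω) (hD : ∀ u ∈ Ω, ∀ j s t, D j u s t = -D j u t s)
    {X X' : S → (Fin N → ℝ) → V} (hX : IsMovingFrame H⁻¹ D Ω X) (hX' : IsMovingFrame H⁻¹ D Ω X')
    (hg : ∀ u ∈ Ω, ∀ s t, B (X s u) (X t u) = H s t)
    (hg' : ∀ u ∈ Ω, ∀ s t, B (X' s u) (X' t u) = H s t) :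
    ∃ A : V ≃ₗ[ℝ] V, (∀ x y, B (A x) (A y) = B x y) ∧ ∀ u ∈ Ω, ∀ s, X' s u = A (X s u) := by
  obtain ⟨p, hp⟩ := hc.nonempty
  have hK : H⁻¹.IsSymm := by rw [Matrix.IsSymm, Matrix.transpose_nonsing_inv, hH]
  have hli := linearIndependent_of_gram (X := fun s => X s p) (hg p hp) hdet
  have hli' := linearIndependent_of_gram (X := fun s => X' s p) (hg' p hp) hdet
  let b := Module.Basis.mk hli (hli.span_eq_top_of_card_eq_finrank' hcard).ge
  let b' := Module.Basis.mk hli' (hli'.span_eq_top_of_card_eq_finrank' hcard).ge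
  let A : V ≃ₗ[ℝ] V := b.equiv b' (Equiv.refl S)
  have hb : ∀ s, b s = X s p := fun s => by simp [b]
  have hb' : ∀ s, b' s = X' s p := fun s => by simp [b']
  have hA : ∀ s, A (X s p) = X' s p := fun s => by
    rw [← hb, ← hb', Module.Basis.equiv_apply]
    rfl
  have hiso : B.comp A.toLinearMap A.toLinearMap = B := by
    refine LinearMap.ext_basis b b fun s t => ?_
    simp only [LinearMap.BilinForm.comp_apply, hb, LinearEquiv.coe_coe, hA, hg p hp, hg' p hp]
  have hTA : ∀ v, ∑ s, (∑ t, H⁻¹ s t * B (X t p) v) • X' s p = A v := fun v => by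
    conv_rhs => rw [← expansion_of_gram (X := fun s => X s p) hcard (hg p hp) hdet v]
    simp only [map_sum, map_smul, hA]
  refine ⟨A, fun x y => LinearMap.congr_fun₂ hiso x y, fun u hu q => ?_⟩
  -- A is the transport map at p, hence also at u, where it visibly sends X_q to X'_q.
  rw [← hTA, ← hX.transport_eq hK hΩ hc.isPreconnected hD hX' (X q u) hu hp]
  simp only [hg u hu]
  have h1 : ∀ s, ∑ t, H⁻¹ s t * H t q = if s = q then 1 else 0 := fun s => by
    rw [← Matrix.mul_apply, Matrix.nonsing_inv_mul _ (isUnit_iff_ne_zero.2 hdet), Matrix.one_apply]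
  simp [h1, ite_smul]

end MovingFrame

section ThirdDerivatives

variable {N : ℕ} {Φ : (Fin N → ℝ) → ℝ} {Ω : Set (Fin N → ℝ)}

theorem pd_pd_pd_comm_left (hΩ : IsOpen Ω) (hΦ : ContDiffOn ℝ ∞ Φ Ω) {u : Fin N → ℝ} (hu : u ∈ Ω)
    (i j k : Fin N) : pd i (pd j (pd k Φ)) u = pd j (pd i (pd k Φ)) u :=
  pd_comm hΩ (contDiffOn_pd hΩ hΦ k) hu i j

theorem pd_pd_pd_comm_right (hΩ : IsOpen Ω) (hΦ : ContDiffOn ℝ ∞ Φ Ω) {u : Fin N → ℝ} (hu : u ∈ Ω)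
    (i j k : Fin N) : pd i (pd j (pd k Φ)) u = pd i (pd k (pd j Φ)) u :=
  pd_congr hΩ (fun _ hv => pd_comm hΩ hΦ hv j k) hu i

theorem pd_pd_pd_comm_outer (hΩ : IsOpen Ω) (hΦ : ContDiffOn ℝ ∞ Φ Ω) {u : Fin N → ℝ} (hu : u ∈ Ω)
    (i j k : Fin N) : pd i (pd j (pd k Φ)) u = pd k (pd j (pd i Φ)) u := by
  rw [pd_pd_pd_comm_left hΩ hΦ hu, pd_pd_pd_comm_right hΩ hΦ hu, pd_pd_pd_comm_left hΩ hΦ hu]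

end ThirdDerivatives

section BlockMatrix

variable {N : ℕ} {η μ : Matrix (Fin N) (Fin N) ℝ}

theorem fromBlocks_inv_diagonal (hη : η.det ≠ 0) (hμ : μ.det ≠ 0) :
    (Matrix.fromBlocks η 0 0 μ)⁻¹ = Matrix.fromBlocks η⁻¹ 0 0 μ⁻¹ := by
  refine Matrix.inv_eq_right_inv ?_
  rw [Matrix.fromBlocks_multiply]
  simp [Matrix.mul_nonsing_inv _ (isUnit_iff_ne_zero.2 hη),
    Matrix.mul_nonsing_inv _ (isUnit_iff_ne_zero.2 hμ)]

theorem isSymm_fromBlocks_diagonal (hη : η.IsSymm) (hμ : μ.IsSymm) :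
    (Matrix.fromBlocks η 0 0 μ).IsSymm :=
  Matrix.IsSymm.fromBlocks hη (by simp) hμ

theorem det_fromBlocks_diagonal_ne_zero (hη : η.det ≠ 0) (hμ : μ.det ≠ 0) :
    (Matrix.fromBlocks η 0 0 μ).det ≠ 0 := by
  rw [Matrix.det_fromBlocks_zero₂₁]
  exact mul_ne_zero hη hμ

end BlockMatrix

/-! ### The adapted frame of a submanifold and its structure equations. -/

/-- The connection coefficients of the frame `(r_{u¹}, …, r_{uᴺ}, n₁, …, n_N)` of a flat
torsionless submanifold with second fundamental forms `F i`. -/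
def frameCoeff {N : ℕ} (F : Fin N → Fin N → Fin N → ℝ) (j : Fin N) :
    Fin N ⊕ Fin N → Fin N ⊕ Fin N → ℝ :=
  Sum.elim (fun i => Sum.elim (fun _ => 0) (fun k => F k j i))
    (fun i => Sum.elim (fun k => -F i j k) (fun _ => 0))

theorem frameCoeff_skew {N : ℕ} (F : Fin N → Fin N → Fin N → ℝ) (j : Fin N)
    (s t : Fin N ⊕ Fin N) : frameCoeff F j s t = -frameCoeff F j t s := by
  rcases s with s | s <;> rcases t with t | t <;> simp [frameCoeff]

section Submanifolds

variable {N : ℕ} {V : Type*} [NormedAddCommGroup V] [NormedSpace ℝ V]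
  {B : LinearMap.BilinForm ℝ V} {Ω : Set (Fin N → ℝ)} {r : (Fin N → ℝ) → V}
  {n : Fin N → (Fin N → ℝ) → V} {η μ : Matrix (Fin N) (Fin N) ℝ} {Φ : (Fin N → ℝ) → ℝ}

/-- The frame `(r_{u¹}, …, r_{uᴺ}, n₁, …, n_N)` along a submanifold. -/
noncomputable def adaptedFrame (r : (Fin N → ℝ) → V) (n : Fin N → (Fin N → ℝ) → V) :
    Fin N ⊕ Fin N → (Fin N → ℝ) → V :=
  Sum.elim (fun i => pd i r) n

theorem gram_adaptedFrame (hB : B.IsSymm) {u : Fin N → ℝ}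
    (h1 : firstForm B r u = η) (h2 : ∀ α i, B (n α u) (pd i r u) = 0)
    (h3 : ∀ i j, B (n i u) (n j u) = μ i j) (s t : Fin N ⊕ Fin N) :
    B (adaptedFrame r n s u) (adaptedFrame r n t u) = Matrix.fromBlocks η 0 0 μ s t := by
  rcases s with s | s <;> rcases t with t | t
  · rw [← h1]; rfl
  · exact (hB.eq _ _).trans (h2 t s)
  · exact h2 s t
  · exact h3 s t

/-- Pairing a relation with the tangent vectors kills its normal part, so nondegeneracy of the first
form alone removes the tangent coefficients. No knowledge of the Gram matrix of the normals is
needed; its nondegeneracy is deduced from this. -/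
theorem linearIndependent_adaptedFrame (hB : B.IsSymm) {u : Fin N → ℝ}
    (h1 : (firstForm B r u).det ≠ 0) (h2 : ∀ α i, B (n α u) (pd i r u) = 0)
    (h3 : LinearIndependent ℝ fun α => n α u) :
    LinearIndependent ℝ fun s => adaptedFrame r n s u := by
  rw [Fintype.linearIndependent_iff]
  intro c hc
  simp only [Fintype.sum_sum_type, adaptedFrame, Sum.elim_inl, Sum.elim_inr] at hc
  have hc1 : (fun i => c (Sum.inl i)) = 0 := by
    refine Matrix.eq_zero_of_mulVec_eq_zero h1 ?_
    ext j
    have h := congrArg (B (pd j r u)) hc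
    simp only [map_add, map_sum, map_smul, map_zero, smul_eq_mul,
      fun x => (hB.eq (pd j r u) (n x u)).trans (h2 x j), mul_zero, Finset.sum_const_zero,
      add_zero] at h
    simpa [Matrix.mulVec, dotProduct, firstForm, mul_comm] using h
  have hc1' : ∀ i, c (Sum.inl i) = 0 := fun i => congrFun hc1 i
  simp only [hc1', zero_smul, Finset.sum_const_zero, zero_add] at hc
  have hc2 := Fintype.linearIndependent_iff.1 h3 _ hc
  rintro (i | i)
  exacts [hc1' i, hc2 i]

theorem isSymm_firstForm (hB : B.IsSymm) (u : Fin N → ℝ) : (firstForm B r u).IsSymm := by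
  ext i j
  exact hB.eq _ _

namespace HasFundamentalForms

variable (h : HasFundamentalForms B η μ Ω r n Φ)
include h

theorem isSymm_first (hB : B.IsSymm) (hne : Ω.Nonempty) : η.IsSymm := by
  obtain ⟨u, hu⟩ := hne
  rw [← h.first u hu]
  exact isSymm_firstForm hB u

theorem det_first_ne_zero (hne : Ω.Nonempty) : η.det ≠ 0 := by
  obtain ⟨u, hu⟩ := hne
  rw [← h.first u hu]
  exact h.submanifold.nonisotropic u hu

theorem isSymm_gram (hB : B.IsSymm) (hne : Ω.Nonempty) : μ.IsSymm := by
  obtain ⟨u, hu⟩ := hne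
  ext i j
  rw [Matrix.transpose_apply, ← h.gram u hu, ← h.gram u hu]
  exact hB.eq _ _

theorem gram_frame (hB : B.IsSymm) {u : Fin N → ℝ} (hu : u ∈ Ω) (s t : Fin N ⊕ Fin N) :
    B (adaptedFrame r n s u) (adaptedFrame r n t u) = Matrix.fromBlocks η 0 0 μ s t :=
  gram_adaptedFrame hB (h.first u hu) (h.frame.normal u hu) (h.gram u hu) s t

theorem det_gram_ne_zero [FiniteDimensional ℝ V] (hV : Module.finrank ℝ V = 2 * N)
    (hB : B.IsSymm) (hBnd : B.Nondegenerate) (hne : Ω.Nonempty) : μ.det ≠ 0 := by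
  obtain ⟨u, hu⟩ := hne
  have hdet := PotentialSubmanifold.det_gram_ne_zero (X := fun s => adaptedFrame r n s u) hBnd
    (by simp [hV, two_mul])
    (linearIndependent_adaptedFrame hB (h.submanifold.nonisotropic u hu) (h.frame.normal u hu)
      (h.frame.independent u hu)) (h.gram_frame hB hu)
  rw [Matrix.det_fromBlocks_zero₂₁] at hdet
  exact right_ne_zero_of_mul hdet

/-- Differentiating the constant inner products of the frame determines all blocks. In the tangent
block, (r_{uᵏ}, r_{uʲuⁱ}) is symmetric in i, j and, the metric being constant, antisymmetric in i,
k; such an array is zero. -/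
theorem bilin_pd_frame [FiniteDimensional ℝ V] (hB : B.IsSymm) (hΩ : IsOpen Ω) {u : Fin N → ℝ}
    (hu : u ∈ Ω) (j : Fin N) (s t : Fin N ⊕ Fin N) :
    B (adaptedFrame r n t u) (pd j (adaptedFrame r n s) u) =
      frameCoeff (fun i j k => pd i (pd j (pd k Φ)) u) j s t := by
  have hr := h.submanifold.smooth
  have hri := fun i => contDiffOn_pd hΩ hr i
  rcases s with i | i <;> rcases t with k | k
  · have key : ∀ i j k : Fin N, B (pd k r u) (pd j (pd i r) u) =
        -B (pd i r u) (pd j (pd k r) u) := by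
      intro i j k
      have h0 := bilin_pd_add_bilin_pd_eq_zero B hΩ (hri k) (hri i) (c := η k i)
        (fun v hv => by rw [← h.first v hv]; rfl) hu j
      have h1 := hB.eq (pd j (pd k r) u) (pd i r u)
      linarith
    have hs : ∀ i j k : Fin N, B (pd k r u) (pd j (pd i r) u) = B (pd k r u) (pd i (pd j r) u) :=
      fun i j k => by rw [pd_comm hΩ hr hu]
    change B (pd k r u) (pd j (pd i r) u) = 0
    have e1 := key i j k
    have e2 := hs k j i
    have e3 := key j k i
    have e4 := hs i k j
    have e5 := key k i j
    have e6 := hs j i k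
    linarith
  · exact h.second u hu k j i
  · have h0 := bilin_pd_add_bilin_pd_eq_zero B hΩ (h.frame.smooth i) (hri k) (c := 0)
      (fun v hv => h.frame.normal v hv i k) hu j
    have h1 := hB.eq (pd j (n i) u) (pd k r u)
    have h2 := h.second u hu i j k
    change B (pd k r u) (pd j (n i) u) = -(pd i (pd j (pd k Φ)) u)
    simp only [secondForm] at h2
    linarith
  · exact (hB.eq _ _).trans (h.torsion u hu i k j)

theorem pd_frame_eq [FiniteDimensional ℝ V] (hV : Module.finrank ℝ V = 2 * N)
    (hB : B.IsSymm) (hBnd : B.Nondegenerate) (hΩ : IsOpen Ω) {u : Fin N → ℝ} (hu : u ∈ Ω)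
    (j : Fin N) (s : Fin N ⊕ Fin N) : pd j (adaptedFrame r n s) u =
      ∑ q, (∑ t, (Matrix.fromBlocks η 0 0 μ)⁻¹ q t *
        frameCoeff (fun i j k => pd i (pd j (pd k Φ)) u) j s t) • adaptedFrame r n q u := by
  rw [← expansion_of_gram (X := fun s => adaptedFrame r n s u) (by simp [hV, two_mul])
    (h.gram_frame hB hu) (det_fromBlocks_diagonal_ne_zero (h.det_first_ne_zero ⟨u, hu⟩)
      (h.det_gram_ne_zero hV hB hBnd ⟨u, hu⟩)) (pd j (adaptedFrame r n s) u)]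
  simp only [h.bilin_pd_frame hB hΩ hu]

theorem isMovingFrame [FiniteDimensional ℝ V] (hV : Module.finrank ℝ V = 2 * N)
    (hB : B.IsSymm) (hBnd : B.Nondegenerate) (hΩ : IsOpen Ω) :
    IsMovingFrame (Matrix.fromBlocks η 0 0 μ)⁻¹
      (fun j u => frameCoeff (fun i j k => pd i (pd j (pd k Φ)) u) j) Ω (adaptedFrame r n) where
  smooth := by
    rintro (i | i)
    exacts [contDiffOn_pd hΩ h.submanifold.smooth i, h.frame.smooth i]
  deriv u hu j s := h.pd_frame_eq hV hB hBnd hΩ hu j s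

/-- The Ricci equations of a torsionless submanifold whose second fundamental forms are the third
derivatives of `Φ` are the associativity equations for `Φ`. -/
theorem satisfiesWDVV [FiniteDimensional ℝ V] (hV : Module.finrank ℝ V = 2 * N)
    (hB : B.IsSymm) (hBnd : B.Nondegenerate) (hΩ : IsOpen Ω) (hΦ : ContDiffOn ℝ ∞ Φ Ω) :
    SatisfiesWDVV η Ω Φ := by
  intro u hu i j m k
  have hη := h.det_first_ne_zero ⟨u, hu⟩
  have hμ := h.det_gram_ne_zero hV hB hBnd ⟨u, hu⟩
  have hsη : η⁻¹.IsSymm := by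
    rw [Matrix.IsSymm, Matrix.transpose_nonsing_inv, h.isSymm_first hB ⟨u, hu⟩]
  -- Without torsion the derivatives of the normals are tangent, so their inner product is a
  -- contraction of two second fundamental forms with η⁻¹: one side of the associativity equations.
  have key : ∀ j m : Fin N, B (pd j (n i) u) (pd m (n k) u) =
      ∑ a, ∑ b, pd i (pd j (pd a Φ)) u * η⁻¹ a b * pd b (pd m (pd k Φ)) u := by
    intro j m
    have h1 : ∀ q, B (pd q r u) (pd m (n k) u) = -pd k (pd m (pd q Φ)) u := fun q =>
      h.bilin_pd_frame hB hΩ hu m (Sum.inr k) (Sum.inl q)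
    have h2 : ∀ q, B (n q u) (pd m (n k) u) = 0 := fun q =>
      h.bilin_pd_frame hB hΩ hu m (Sum.inr k) (Sum.inr q)
    have h3 := h.pd_frame_eq hV hB hBnd hΩ hu j (Sum.inr i)
    rw [fromBlocks_inv_diagonal hη hμ] at h3
    simp only [adaptedFrame, frameCoeff, Sum.elim_inr, Fintype.sum_sum_type, Sum.elim_inl,
      Matrix.fromBlocks_apply₁₁, Matrix.fromBlocks_apply₂₁,
      Matrix.zero_apply, mul_zero, zero_mul, Finset.sum_const_zero,
      add_zero, zero_smul] at h3
    rw [h3]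
    simp only [map_sum, map_smul, LinearMap.sum_apply, LinearMap.smul_apply, smul_eq_mul, h1,
      Finset.sum_mul]
    rw [Finset.sum_comm]
    refine Finset.sum_congr rfl fun a _ => Finset.sum_congr rfl fun b _ => ?_
    rw [pd_pd_pd_comm_outer hΩ hΦ hu k m b, show η⁻¹ b a = η⁻¹ a b from hsη.apply a b]
    ring
  rw [← key j m, ← key m j]
  -- Differentiating the vanishing torsion and using the symmetry of ∂ₘ∂ⱼnᵢ exchanges j and m in the
  -- contraction.
  have hric : ∀ j m : Fin N,
      B (pd m (pd j (n i)) u) (n k u) + B (pd j (n i) u) (pd m (n k) u) = 0 :=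
    fun j m => bilin_pd_add_bilin_pd_eq_zero B hΩ (contDiffOn_pd hΩ (h.frame.smooth i) j)
      (h.frame.smooth k) (c := 0) (fun v hv => h.torsion v hv i k j) hu m
  have e1 := hric j m
  have e2 := hric m j
  rw [pd_comm hΩ (h.frame.smooth i) hu m j] at e1
  linarith

end HasFundamentalForms
end Submanifolds

/-! ### Functions with vanishing third derivatives. -/

section Quadratic

variable {N : ℕ} {Ω : Set (Fin N → ℝ)} {Ψ : (Fin N → ℝ) → ℝ}

theorem pd_quadratic (a : Fin N → Fin N → ℝ) (b : Fin N → ℝ) (d : ℝ) (k : Fin N)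
    (u : Fin N → ℝ) : pd k (fun u => ∑ i, ∑ j, a i j * u i * u j + ∑ i, b i * u i + d) u =
      ∑ j, (a k j + a j k) * u j + b k := by
  have hc : ∀ i : Fin N, DifferentiableAt ℝ (fun u : Fin N → ℝ => u i) u := fun i => by fun_prop
  have h1 : ∀ i j, pd k (fun u : Fin N → ℝ => a i j * u i * u j) u =
      (a i j * if k = i then 1 else 0) * u j + a i j * u i * if k = j then 1 else 0 := fun i j => by
    rw [pd_mul (by fun_prop) (hc j), pd_const_mul _ (hc i), pd_coord, pd_coord]
  rw [pd_add (by fun_prop) (by fun_prop), pd_add (by fun_prop) (by fun_prop), pd_const, add_zero,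
    pd_sum (fun i => by fun_prop), pd_sum (fun i => by fun_prop)]
  congr 1
  · simp only [fun i => pd_sum (u := u) (f := fun j (u : Fin N → ℝ) => a i j * u i * u j)
      (fun j => by fun_prop) k, h1, Finset.sum_add_distrib]
    simp [add_mul, Finset.sum_add_distrib]
  · simp only [pd_const_mul _ (hc _), pd_coord]
    simp

theorem pd_pd_pd_quadratic (a : Fin N → Fin N → ℝ) (b : Fin N → ℝ) (d : ℝ) (i j k : Fin N)
    (u : Fin N → ℝ) : pd i (pd j (pd k
      (fun u => ∑ i, ∑ j, a i j * u i * u j + ∑ i, b i * u i + d))) u = 0 := by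
  have h1 : pd k (fun u => ∑ i, ∑ j, a i j * u i * u j + ∑ i, b i * u i + d) =
      fun u => ∑ j, (a k j + a j k) * u j + b k := funext fun u => pd_quadratic a b d k u
  have h2 : pd j (fun u => ∑ j, (a k j + a j k) * u j + b k) = fun _ => a k j + a j k := by
    funext u
    have hc : ∀ i : Fin N, DifferentiableAt ℝ (fun u : Fin N → ℝ => u i) u := fun i => by fun_prop
    rw [pd_add (by fun_prop) (by fun_prop), pd_const, add_zero, pd_sum (fun i => by fun_prop)]
    simp only [pd_const_mul _ (hc _), pd_coord]
    simp
  rw [h1, h2, pd_const]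

theorem pd_pd_pd_add (hΩ : IsOpen Ω) {Φ Φ' : (Fin N → ℝ) → ℝ} (h : ContDiffOn ℝ ∞ Φ Ω)
    (h' : ContDiffOn ℝ ∞ Φ' Ω) (i j k : Fin N) {u : Fin N → ℝ} (hu : u ∈ Ω) :
    pd i (pd j (pd k fun v => Φ v + Φ' v)) u =
      pd i (pd j (pd k Φ)) u + pd i (pd j (pd k Φ')) u := by
  have hd := fun {f : (Fin N → ℝ) → ℝ} (hf : ContDiffOn ℝ ∞ f Ω) {u : Fin N → ℝ} (hu : u ∈ Ω) =>
    differentiableAt_of_contDiffOn hΩ hf hu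
  have h1 : ∀ u ∈ Ω, pd j (pd k fun v => Φ v + Φ' v) u = pd j (pd k Φ) u + pd j (pd k Φ') u := by
    intro u hu
    rw [pd_congr hΩ (fun v hv => pd_add (hd h hv) (hd h' hv) k) hu,
      pd_add (hd (contDiffOn_pd hΩ h k) hu) (hd (contDiffOn_pd hΩ h' k) hu)]
  rw [pd_congr hΩ h1 hu, pd_add (hd (contDiffOn_pd hΩ (contDiffOn_pd hΩ h k) j) hu)
    (hd (contDiffOn_pd hΩ (contDiffOn_pd hΩ h' k) j) hu)]

/-- A function with vanishing third derivatives on a connected open set is a polynomial of degree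
at most two. -/
theorem exists_quadratic (hΩ : IsOpen Ω) (hc : IsConnected Ω) (hΨ : ContDiffOn ℝ ∞ Ψ Ω)
    (h : ∀ u ∈ Ω, ∀ i j k, pd i (pd j (pd k Ψ)) u = 0) :
    ∃ (a : Fin N → Fin N → ℝ) (b : Fin N → ℝ) (d : ℝ), ∀ u ∈ Ω,
      Ψ u = ∑ i, ∑ j, a i j * u i * u j + ∑ i, b i * u i + d := by
  obtain ⟨p, hp⟩ := hc.nonempty
  have hd := fun {f : (Fin N → ℝ) → ℝ} (hf : ContDiffOn ℝ ∞ f Ω) {u : Fin N → ℝ} (hu : u ∈ Ω) =>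
    differentiableAt_of_contDiffOn hΩ hf hu
  set c : Fin N → Fin N → ℝ := fun j k => pd j (pd k Ψ) p with hcdef
  have hsymm : ∀ j k, c j k = c k j := fun j k => pd_comm hΩ hΨ hp j k
  have h2 : ∀ u ∈ Ω, ∀ j k, pd j (pd k Ψ) u = c j k := fun u hu j k =>
    eq_of_pd_eq_zero hΩ hc.isPreconnected
      (fun u hu => hd (contDiffOn_pd hΩ (contDiffOn_pd hΩ hΨ k) j) hu)
      (fun u hu i => h u hu i j k) hu hp
  set b : Fin N → ℝ := fun k => pd k Ψ p - ∑ j, c k j * p j with hb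
  have hlin : ∀ k (u : Fin N → ℝ), DifferentiableAt ℝ (fun u : Fin N → ℝ => ∑ j, c k j * u j) u :=
    fun k u => by fun_prop
  have hco : ∀ (i : Fin N) (u : Fin N → ℝ), DifferentiableAt ℝ (fun u : Fin N → ℝ => u i) u :=
    fun i u => by fun_prop
  have h1 : ∀ u ∈ Ω, ∀ k, pd k Ψ u = ∑ j, c k j * u j + b k := by
    intro u hu k
    have := eq_of_pd_eq_zero hΩ hc.isPreconnected (f := fun u => pd k Ψ u - ∑ j, c k j * u j)
      (fun u hu => (hd (contDiffOn_pd hΩ hΨ k) hu).sub (hlin k u))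
      (fun u hu i => by
        rw [pd_sub (hd (contDiffOn_pd hΩ hΨ k) hu) (hlin k u), h2 u hu,
          pd_sum (fun j => by fun_prop)]
        simp only [pd_const_mul _ (hco _ u), pd_coord]
        simp [hsymm i k]) hu hp
    simp only [hb]
    linarith
  -- The Hessian c is symmetric, so the form with coefficients c/2 has gradient c u.
  set Q : (Fin N → ℝ) → ℝ := fun u => ∑ i, ∑ j, (c i j / 2) * u i * u j + ∑ i, b i * u i + 0 with hQ
  have hQd : ∀ u, DifferentiableAt ℝ Q u := fun u => by rw [hQ]; fun_prop
  refine ⟨fun i j => c i j / 2, b, Ψ p - Q p, fun u hu => ?_⟩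
  have h0 := eq_of_pd_eq_zero hΩ hc.isPreconnected (f := fun u => Ψ u - Q u)
      (fun u hu => (hd hΨ hu).sub (hQd u))
      (fun u hu k => by
        rw [pd_sub (hd hΨ hu) (hQd u), h1 u hu, hQ, pd_quadratic]
        simp only [hsymm _ k, add_halves, sub_self]) hu hp
  have h3 : Q u = ∑ i, ∑ j, (c i j / 2) * u i * u j + ∑ i, b i * u i := by rw [hQ]; simp
  linarith

end Quadratic

/-! ### Uniqueness up to motions. -/

section Uniqueness

variable {N : ℕ} {V : Type*} [NormedAddCommGroup V] [NormedSpace ℝ V] [FiniteDimensional ℝ V]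
  {B : LinearMap.BilinForm ℝ V} {Ω : Set (Fin N → ℝ)} {r r' : (Fin N → ℝ) → V}
  {n n' : Fin N → (Fin N → ℝ) → V} {η μ : Matrix (Fin N) (Fin N) ℝ} {Φ Φ' : (Fin N → ℝ) → ℝ}

/-- Equal third derivatives mean equal connection coefficients, so one constant isometry A carries
frame to frame. Then r' - A r has zero gradient, and its constant value is the translation. -/
theorem equalUpToMotion_of_third_derivatives_eq (hV : Module.finrank ℝ V = 2 * N)
    (hB : B.IsSymm) (hBnd : B.Nondegenerate) (hΩ : IsOpen Ω) (hc : IsConnected Ω)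
    (h : HasFundamentalForms B η μ Ω r n Φ) (h' : HasFundamentalForms B η μ Ω r' n' Φ')
    (h3 : ∀ u ∈ Ω, ∀ i j k, pd i (pd j (pd k Φ')) u = pd i (pd j (pd k Φ)) u) :
    EqualUpToMotion B Ω r n r' n' := by
  have hF' : IsMovingFrame (Matrix.fromBlocks η 0 0 μ)⁻¹
      (fun j u => frameCoeff (fun i j k => pd i (pd j (pd k Φ)) u) j) Ω (adaptedFrame r' n') := by
    refine ⟨(h'.isMovingFrame hV hB hBnd hΩ).smooth, fun u hu j s => ?_⟩
    rw [(h'.isMovingFrame hV hB hBnd hΩ).deriv u hu]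
    simp only [h3 u hu]
  obtain ⟨A, hA, hAX⟩ := exists_isometry_of_frames (by simp [hV, two_mul])
    (isSymm_fromBlocks_diagonal (h.isSymm_first hB hc.nonempty) (h.isSymm_gram hB hc.nonempty))
    (det_fromBlocks_diagonal_ne_zero (h.det_first_ne_zero hc.nonempty)
      (h.det_gram_ne_zero hV hB hBnd hc.nonempty)) hΩ hc
    (fun u _ j s t => frameCoeff_skew (fun i j k => pd i (pd j (pd k Φ)) u) j s t)
    (h.isMovingFrame hV hB hBnd hΩ) hF'
    (fun u hu => h.gram_frame hB hu) (fun u hu => h'.gram_frame hB hu)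
  obtain ⟨p, hp⟩ := hc.nonempty
  have hAr : ContDiffOn ℝ ∞ (fun u => A (r u)) Ω :=
    contDiffOn_linearMap A.toLinearMap h.submanifold.smooth
  refine ⟨A, r' p - A (r p), hA, fun u hu => ⟨?_, fun i => hAX u hu (Sum.inr i)⟩⟩
  have := eq_of_pd_eq_zero hΩ hc.isPreconnected (f := fun u => r' u - A (r u))
    (fun u hu => (differentiableAt_of_contDiffOn hΩ h'.submanifold.smooth hu).sub
      (differentiableAt_of_contDiffOn hΩ hAr hu))
    (fun u hu i => by
      rw [pd_sub (differentiableAt_of_contDiffOn hΩ h'.submanifold.smooth hu)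
        (differentiableAt_of_contDiffOn hΩ hAr hu)]
      have h1 : pd i (fun u => A (r u)) u = A (pd i r u) := pd_linearMap A.toLinearMap
        (differentiableAt_of_contDiffOn hΩ h.submanifold.smooth hu) i
      have h2 : pd i r' u = A (pd i r u) := hAX u hu (Sum.inl i)
      rw [h1, h2, sub_self]) hu hp
  rw [← this]
  abel

/-- The third derivatives are the inner products (nᵢ, r_{uʲuᵏ}), which an isometry preserves and a
translation does not affect. -/
theorem third_derivatives_eq_of_equalUpToMotion (hΩ : IsOpen Ω)
    (h : HasFundamentalForms B η μ Ω r n Φ) (h' : HasFundamentalForms B η μ Ω r' n' Φ')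
    (hm : EqualUpToMotion B Ω r n r' n') {u : Fin N → ℝ} (hu : u ∈ Ω) (i j k : Fin N) :
    pd i (pd j (pd k Φ')) u = pd i (pd j (pd k Φ)) u := by
  obtain ⟨A, w, hA, hAr⟩ := hm
  have hd := fun {f : (Fin N → ℝ) → V} (hf : ContDiffOn ℝ ∞ f Ω) {u : Fin N → ℝ} (hu : u ∈ Ω) =>
    differentiableAt_of_contDiffOn hΩ hf hu
  have hr := h.submanifold.smooth
  have hcomp : ∀ {f : (Fin N → ℝ) → V}, ContDiffOn ℝ ∞ f Ω → ∀ u ∈ Ω, ∀ i,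
      pd i (fun v => A (f v)) u = A (pd i f u) := fun hf u hu i =>
    pd_linearMap A.toLinearMap (hd hf hu) i
  have h1 : ∀ v ∈ Ω, pd k r' v = A (pd k r v) := fun v hv => by
    have hAs : ContDiffOn ℝ ∞ (fun v => A (r v)) Ω := contDiffOn_linearMap A.toLinearMap hr
    rw [pd_congr hΩ (fun v hv => (hAr v hv).1) hv,
      pd_add (hd hAs hv) (differentiableAt_const w), pd_const, add_zero, hcomp hr v hv]
  rw [← h'.second u hu, ← h.second u hu, secondForm, secondForm, pd_congr hΩ h1 hu,
    hcomp (contDiffOn_pd hΩ hr k) u hu, (hAr u hu).2, hA]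

theorem equalUpToMotion_iff (hV : Module.finrank ℝ V = 2 * N)
    (hB : B.IsSymm) (hBnd : B.Nondegenerate) (hΩ : IsOpen Ω) (hc : IsConnected Ω)
    (hΦ : ContDiffOn ℝ ∞ Φ Ω) (hΦ' : ContDiffOn ℝ ∞ Φ' Ω)
    (h : HasFundamentalForms B η μ Ω r n Φ) (h' : HasFundamentalForms B η μ Ω r' n' Φ') :
    EqualUpToMotion B Ω r n r' n' ↔
      ∃ (a : Fin N → Fin N → ℝ) (b : Fin N → ℝ) (d : ℝ), ∀ u ∈ Ω,
        Φ' u = Φ u + ∑ i, ∑ j, a i j * u i * u j + ∑ i, b i * u i + d := by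
  constructor
  · intro hm
    have hs : ContDiffOn ℝ ∞ (fun u => Φ' u - Φ u) Ω := hΦ'.sub hΦ
    obtain ⟨a, b, d, hq⟩ := exists_quadratic hΩ hc hs fun u hu i j k => by
      have h1 := pd_pd_pd_add hΩ hΦ hs i j k hu
      simp only [add_sub_cancel] at h1
      have h2 := third_derivatives_eq_of_equalUpToMotion hΩ h h' hm hu i j k
      have h3 : (fun v => Φ' v) = Φ' := rfl
      rw [h3] at h1
      linarith
    exact ⟨a, b, d, fun u hu => by linarith [hq u hu]⟩
  · rintro ⟨a, b, d, hq⟩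
    refine equalUpToMotion_of_third_derivatives_eq hV hB hBnd hΩ hc h h' fun u hu i j k => ?_
    set Q : (Fin N → ℝ) → ℝ := fun u => ∑ i, ∑ j, a i j * u i * u j + ∑ i, b i * u i + d with hQ
    have hQs : ContDiffOn ℝ ∞ Q Ω := by rw [hQ]; fun_prop
    have hq' : ∀ u ∈ Ω, Φ' u = Φ u + Q u := fun u hu => by rw [hq u hu, hQ]; ring
    have e1 : ∀ u ∈ Ω, pd j (pd k Φ') u = pd j (pd k fun v => Φ v + Q v) u := fun u hu =>
      pd_congr hΩ (fun v hv => pd_congr hΩ hq' hv k) hu j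
    rw [pd_congr hΩ e1 hu, pd_pd_pd_add hΩ hΦ hQs i j k hu, hQ, pd_pd_pd_quadratic, add_zero]

end Uniqueness

/-! ### Constant metrics have no connection terms. -/

section FlatCoordinates

variable {N : ℕ} {Ω : Set (Fin N → ℝ)} {η : Matrix (Fin N) (Fin N) ℝ}
  {g : (Fin N → ℝ) → Matrix (Fin N) (Fin N) ℝ}

theorem christoffel_eq_zero (hΩ : IsOpen Ω) (hg : ∀ u ∈ Ω, g u = η) {u : Fin N → ℝ} (hu : u ∈ Ω)
    (k i j : Fin N) : christoffel g k i j u = 0 := by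
  have h : ∀ i a b : Fin N, pd i (fun v => g v a b) u = 0 := fun i a b => by
    rw [pd_congr hΩ (g := fun _ => η a b) (fun v hv => by rw [hg v hv]) hu, pd_const]
  simp [christoffel, h]

theorem riemann_eq_zero (hΩ : IsOpen Ω) (hg : ∀ u ∈ Ω, g u = η) {u : Fin N → ℝ} (hu : u ∈ Ω)
    (l k i j : Fin N) : riemann g l k i j u = 0 := by
  have h : ∀ i a b c : Fin N, pd i (christoffel g a b c) u = 0 := fun i a b c => by
    rw [pd_congr hΩ (g := fun _ => (0 : ℝ)) (fun v hv => christoffel_eq_zero hΩ hg hv a b c) hu,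
      pd_const]
  simp [riemann, h, christoffel_eq_zero hΩ hg hu]

theorem cov3_eq_pd (hΩ : IsOpen Ω) (hg : ∀ u ∈ Ω, g u = η) (Φ : (Fin N → ℝ) → ℝ) {u : Fin N → ℝ}
    (hu : u ∈ Ω) (i j k : Fin N) : cov3 g Φ i j k u = pd i (pd j (pd k Φ)) u := by
  have h : ∀ v ∈ Ω, cov2 g Φ j k v = pd j (pd k Φ) v := fun v hv => by
    simp [cov2, christoffel_eq_zero hΩ hg hv]
  simp [cov3, christoffel_eq_zero hΩ hg hu, pd_congr hΩ h hu]

end FlatCoordinates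

/-! ### Realization of solutions of the associativity equations. -/

section Existence

variable {N : ℕ} {V : Type*} [NormedAddCommGroup V] [NormedSpace ℝ V]
  {B : LinearMap.BilinForm ℝ V} {Ω : Set (Fin N → ℝ)} {r : (Fin N → ℝ) → V}
  {n : Fin N → (Fin N → ℝ) → V} {η μ : Matrix (Fin N) (Fin N) ℝ} {Φ : (Fin N → ℝ) → ℝ}

theorem HasFundamentalForms.isPotentialSubmanifold (h : HasFundamentalForms B η μ Ω r n Φ)
    (hΩ : IsOpen Ω) (hΦ : ContDiffOn ℝ ∞ Φ Ω) : IsPotentialSubmanifold B Ω r where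
  submanifold := h.submanifold
  flat u hu l k i j := riemann_eq_zero hΩ h.first hu l k i j
  torsionless p hp := ⟨Ω, hΩ, hp, subset_rfl, n, μ, h.frame, h.gram, h.torsion⟩
  potential p hp := ⟨Ω, hΩ, hp, subset_rfl, n, Φ, hΦ, h.frame,
    fun u hu i j l => by simp [h.torsion u hu, christoffel_eq_zero hΩ h.first hu],
    fun u hu i j k => by rw [h.second u hu, cov3_eq_pd hΩ h.first Φ hu]⟩

variable [FiniteDimensional ℝ V]

/-- A moving frame with constant Gram matrix, whose tangent part is the gradient of `r`, realizes
the fundamental forms given by its connection coefficients. -/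
theorem hasFundamentalForms_of_frame (hΩ : IsOpen Ω) (hη : η.det ≠ 0)
    (hμ : μ.det ≠ 0) (hr : ContDiffOn ℝ ∞ r Ω) {X : Fin N ⊕ Fin N → (Fin N → ℝ) → V}
    (hX : IsMovingFrame (Matrix.fromBlocks η 0 0 μ)⁻¹
      (fun j u => frameCoeff (fun i j k => pd i (pd j (pd k Φ)) u) j) Ω X)
    (hrX : ∀ u ∈ Ω, ∀ j, pd j r u = X (Sum.inl j) u)
    (hg : ∀ u ∈ Ω, ∀ s t, B (X s u) (X t u) = Matrix.fromBlocks η 0 0 μ s t) :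
    HasFundamentalForms B η μ Ω r (fun i => X (Sum.inr i)) Φ := by
  have hdet := det_fromBlocks_diagonal_ne_zero hη hμ
  have hli : ∀ u ∈ Ω, LinearIndependent ℝ fun s => X s u := fun u hu =>
    linearIndependent_of_gram (hg u hu) hdet
  have hD : ∀ u ∈ Ω, ∀ j s t, B (X t u) (pd j (X s) u) =
      frameCoeff (fun i j k => pd i (pd j (pd k Φ)) u) j s t := fun u hu j s t =>
    bilin_pd_of_deriv (X := fun s => X s u) hdet (hg u hu) (hX.deriv u hu j s) t
  have hfirst : ∀ u ∈ Ω, firstForm B r u = η := fun u hu => by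
    ext i j
    rw [firstForm, Matrix.of_apply, hrX u hu, hrX u hu, hg u hu, Matrix.fromBlocks_apply₁₁]
  refine ⟨⟨hr, fun u hu => ?_, fun u hu => by rwa [hfirst u hu]⟩,
    ⟨fun α => hX.smooth _, fun u hu α i => ?_, fun u hu => ?_⟩, hfirst, fun u hu i j => ?_,
    fun u hu i j k => ?_, fun u hu i j k => ?_⟩
  · simp only [hrX u hu]
    exact (hli u hu).comp Sum.inl Sum.inl_injective
  · rw [hrX u hu, hg u hu, Matrix.fromBlocks_apply₂₁, Matrix.zero_apply]
  · exact (hli u hu).comp Sum.inr Sum.inr_injective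
  · rw [hg u hu, Matrix.fromBlocks_apply₂₂]
  · have h0 := bilin_pd_add_bilin_pd_eq_zero B hΩ (hX.smooth (Sum.inr i)) (hX.smooth (Sum.inr j))
      (fun v hv => hg v hv _ _) hu k
    rw [hD u hu] at h0
    have h1 : B (pd k (X (Sum.inr i)) u) (X (Sum.inr j) u) = 0 := by simpa [frameCoeff] using h0
    exact h1
  · rw [secondForm, pd_congr hΩ (fun v hv => hrX v hv k) hu, hD u hu]
    rfl

/-- Every solution of the associativity equations on a simply connected domain is realized by a
submanifold. -/
theorem exists_hasFundamentalForms_of_satisfiesWDVV (hV : Module.finrank ℝ V = 2 * N) {c : ℝ}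
    (hηs : η.IsSymm) (hη : η.det ≠ 0) (hμs : μ.IsSymm) (hμ : μ.det ≠ 0) (hc : μ⁻¹ = c • η⁻¹)
    (b : Fin N ⊕ Fin N → V) (hb : ∀ s t, B (b s) (b t) = Matrix.fromBlocks η 0 0 μ s t)
    (hΩ : IsOpen Ω) (hsc : IsSimplyConnected Ω) (hΦ : ContDiffOn ℝ ∞ Φ Ω)
    (hW : SatisfiesWDVV η Ω Φ) :
    ∃ (r : (Fin N → ℝ) → V) (n : Fin N → (Fin N → ℝ) → V), HasFundamentalForms B η μ Ω r n Φ := by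
  obtain ⟨p, hp⟩ := hsc.nonempty
  have hη' : η⁻¹.IsSymm := by rw [Matrix.IsSymm, Matrix.transpose_nonsing_inv, hηs]
  have h3 : ∀ i j k, ContDiffOn ℝ ∞ (pd i (pd j (pd k Φ))) Ω := fun i j k =>
    contDiffOn_pd hΩ (contDiffOn_pd hΩ (contDiffOn_pd hΩ hΦ k) j) i
  have hd3 : ∀ u ∈ Ω, ∀ i j k, DifferentiableAt ℝ (pd i (pd j (pd k Φ))) u := fun u hu i j k =>
    differentiableAt_of_contDiffOn hΩ (h3 i j k) hu
  set D : Fin N → (Fin N → ℝ) → Fin N ⊕ Fin N → Fin N ⊕ Fin N → ℝ :=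
    fun j u => frameCoeff (fun i j k => pd i (pd j (pd k Φ)) u) j with hD
  have hDs : ∀ j s t, ContDiffOn ℝ ∞ (fun u => D j u s t) Ω := by
    rintro j (s | s) (t | t)
    exacts [contDiffOn_const, h3 _ _ _, (h3 _ _ _).neg, contDiffOn_const]
  set A : Fin N → (Fin N → ℝ) → Fin N ⊕ Fin N → Fin N ⊕ Fin N → ℝ :=
    fun j u s q => ∑ t, (Matrix.fromBlocks η 0 0 μ)⁻¹ q t * D j u s t with hA
  have hAll : ∀ j u i q, A j u (Sum.inl i) (Sum.inl q) = 0 := fun j u i q => by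
    simp [hA, hD, fromBlocks_inv_diagonal hη hμ, frameCoeff]
  have hArr : ∀ j u i q, A j u (Sum.inr i) (Sum.inr q) = 0 := fun j u i q => by
    simp [hA, hD, fromBlocks_inv_diagonal hη hμ, frameCoeff]
  have hAlr : ∀ j u i q, A j u (Sum.inl i) (Sum.inr q) =
      ∑ t, c * η⁻¹ q t * pd t (pd j (pd i Φ)) u := fun j u i q => by
    simp [hA, hD, fromBlocks_inv_diagonal hη hμ, frameCoeff, hc]
  have hArl : ∀ j u i q, A j u (Sum.inr i) (Sum.inl q) =
      ∑ t, -η⁻¹ q t * pd i (pd j (pd t Φ)) u := fun j u i q => by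
    simp [hA, hD, fromBlocks_inv_diagonal hη hμ, frameCoeff]
  have hAs : ∀ j s t, ContDiffOn ℝ ∞ (fun u => A j u s t) Ω := fun j s t =>
    ContDiffOn.sum fun q _ => contDiffOn_const.mul (hDs j s q)
  have hsymm : ∀ u ∈ Ω, ∀ i j k a, pd i (pd k (pd j (pd a Φ))) u = pd j (pd k (pd i (pd a Φ))) u :=
    fun u hu i j k a => pd_pd_pd_comm_outer hΩ (contDiffOn_pd hΩ hΦ a) hu i k j
  -- The derivative part of integrability is automatic: it only involves fourth derivatives of Φ.
  -- What remains is that the matrices Aᵢ commute.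
  have hclosed : ∀ u ∈ Ω, ∀ i j s t, pd i (fun v => A j v s t) u = pd j (fun v => A i v s t) u := by
    rintro u hu i j (a | a) (m | m)
    · simp only [hAll]
      rw [pd_const, pd_const]
    · have key : ∀ i j, pd i (fun v => A j v (Sum.inl a) (Sum.inr m)) u =
          ∑ t, c * η⁻¹ m t * pd i (pd t (pd j (pd a Φ))) u := fun i j => by
        simp only [hAlr]
        rw [pd_sum fun t => (hd3 u hu _ _ _).const_mul _]
        exact Finset.sum_congr rfl fun t _ => pd_const_mul _ (hd3 u hu _ _ _) i
      rw [key, key]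
      simp only [hsymm u hu i j]
    · have key : ∀ i j, pd i (fun v => A j v (Sum.inr a) (Sum.inl m)) u =
          ∑ t, -η⁻¹ m t * pd i (pd a (pd j (pd t Φ))) u := fun i j => by
        simp only [hArl]
        rw [pd_sum fun t => (hd3 u hu _ _ _).const_mul _]
        exact Finset.sum_congr rfl fun t _ => pd_const_mul _ (hd3 u hu _ _ _) i
      rw [key, key]
      simp only [hsymm u hu i j]
    · simp only [hArr]
      rw [pd_const, pd_const]
  have hprod : ∀ (m : Fin N) (α : Fin N → ℝ) (β : Fin N → Fin N → ℝ),
      ∑ q, (∑ s, η⁻¹ q s * α s) * ∑ t, η⁻¹ m t * β q t =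
        ∑ t, η⁻¹ m t * ∑ k, ∑ l, α k * η⁻¹ k l * β l t := by
    intro m α β
    simp only [Finset.mul_sum, Finset.sum_mul]
    rw [Finset.sum_comm]
    refine Finset.sum_congr rfl fun t _ => ?_
    rw [Finset.sum_comm]
    refine Finset.sum_congr rfl fun k _ => Finset.sum_congr rfl fun l _ => ?_
    rw [show η⁻¹ l k = η⁻¹ k l from hη'.apply k l]
    ring
  -- The tangent (Gauss) and normal (Ricci) blocks of AⱼAᵢ come out identical, because μ⁻¹ = c η⁻¹;
  -- both are one side of the associativity equations contracted with -c η⁻¹.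
  have hll : ∀ u ∈ Ω, ∀ i j a m,
      ∑ q, A j u (Sum.inl a) (Sum.inr q) * A i u (Sum.inr q) (Sum.inl m) =
      -c * ∑ t, η⁻¹ m t * ∑ k, ∑ l,
        pd a (pd j (pd k Φ)) u * η⁻¹ k l * pd l (pd i (pd t Φ)) u := by
    intro u hu i j a m
    rw [← hprod m (fun k => pd a (pd j (pd k Φ)) u) (fun l t => pd l (pd i (pd t Φ)) u),
      Finset.mul_sum]
    refine Finset.sum_congr rfl fun q _ => ?_
    simp only [hAlr, hArl, mul_assoc, neg_mul, Finset.sum_neg_distrib, ← Finset.mul_sum,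
      pd_pd_pd_comm_outer hΩ hΦ hu _ j a]
    ring
  have hrr : ∀ u ∈ Ω, ∀ i j a m,
      ∑ q, A j u (Sum.inr a) (Sum.inl q) * A i u (Sum.inl q) (Sum.inr m) =
      -c * ∑ t, η⁻¹ m t * ∑ k, ∑ l,
        pd a (pd j (pd k Φ)) u * η⁻¹ k l * pd l (pd i (pd t Φ)) u := by
    intro u hu i j a m
    rw [← hprod m (fun k => pd a (pd j (pd k Φ)) u) (fun l t => pd l (pd i (pd t Φ)) u),
      Finset.mul_sum]
    refine Finset.sum_congr rfl fun q _ => ?_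
    simp only [hAlr, hArl, mul_assoc, neg_mul, Finset.sum_neg_distrib, ← Finset.mul_sum,
      pd_pd_pd_comm_outer hΩ hΦ hu _ i q]
    ring
  obtain ⟨r, X, hX0, hr, hXs, hrX, hX⟩ := exists_frame_and_primitive hΩ hsc hAs
    (by
      rintro u hu i j (a | a) (m | m)
      · rw [hclosed u hu i j]
        simp only [Fintype.sum_sum_type, hAll, zero_mul, Finset.sum_const_zero, zero_add, hll u hu]
        simp only [hW u hu a i j]
      · rw [hclosed u hu i j]
        simp [Fintype.sum_sum_type, hAll, hArr]
      · rw [hclosed u hu i j]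
        simp [Fintype.sum_sum_type, hAll, hArr]
      · rw [hclosed u hu i j]
        simp only [Fintype.sum_sum_type, hArr, zero_mul, Finset.sum_const_zero, add_zero, hrr u hu]
        simp only [hW u hu a i j])
    -- The equation for r is ∂ⱼr = X_j with X_j tangent; its compatibility is the symmetry of the
    -- third derivatives in i and j.
    Sum.inl
    (by
      rintro u hu i j (t | t)
      · rw [hAll, hAll]
      · simp only [hAlr, pd_pd_pd_comm_right hΩ hΦ hu _ i j])
    hp b
  have hF : IsMovingFrame (Matrix.fromBlocks η 0 0 μ)⁻¹ D Ω X := ⟨hXs, hX⟩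
  exact ⟨r, fun i => X (Sum.inr i), hasFundamentalForms_of_frame hΩ hη hμ hr hF hrX
    fun u hu s t => hF.gram_eq (by simp [hV, two_mul]) (isSymm_fromBlocks_diagonal hηs hμs)
      (det_fromBlocks_diagonal_ne_zero hη hμ) hΩ hsc.isPathConnected.isConnected.isPreconnected
      (fun u _ j s t => frameCoeff_skew (fun i j k => pd i (pd j (pd k Φ)) u) j s t) hp
      (fun s t => by rw [hX0, hX0, hb]) hu s t⟩

theorem satisfiesWDVV_iff (hV : Module.finrank ℝ V = 2 * N) (hB : B.IsSymm)
    (hBnd : B.Nondegenerate) {c : ℝ} (hηs : η.IsSymm) (hη : η.det ≠ 0) (hc : c ≠ 0)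
    (b : Fin N ⊕ Fin N → V) (hb : ∀ s t, B (b s) (b t) = Matrix.fromBlocks η 0 0 (c⁻¹ • η) s t)
    (hΩ : IsOpen Ω) (hsc : IsSimplyConnected Ω) (hΦ : ContDiffOn ℝ ∞ Φ Ω) :
    SatisfiesWDVV η Ω Φ ↔ ∃ (r : (Fin N → ℝ) → V) (n : Fin N → (Fin N → ℝ) → V),
      IsPotentialSubmanifold B Ω r ∧ HasFundamentalForms B η (c⁻¹ • η) Ω r n Φ := by
  constructor
  · intro hW
    have hμ : (c⁻¹ • η)⁻¹ = c • η⁻¹ := by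
      refine Matrix.inv_eq_right_inv ?_
      rw [smul_mul_smul_comm, inv_mul_cancel₀ hc, one_smul,
        Matrix.mul_nonsing_inv _ (isUnit_iff_ne_zero.2 hη)]
    have hdet : (c⁻¹ • η).det ≠ 0 := by
      rw [Matrix.det_smul]
      exact mul_ne_zero (pow_ne_zero _ (inv_ne_zero hc)) hη
    obtain ⟨r, n, h⟩ := exists_hasFundamentalForms_of_satisfiesWDVV hV hηs hη (hηs.smul c⁻¹) hdet
      hμ b hb hΩ hsc hΦ hW
    exact ⟨r, n, h.isPotentialSubmanifold hΩ hΦ, h⟩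
  · rintro ⟨r, n, -, h⟩
    exact h.satisfiesWDVV hV hB hBnd hΩ hΦ

end Existence

/-! ### Covariant derivatives in flat coordinates, and smooth local inverses. -/

section Pullback

variable {N : ℕ} {F : Type*} [NormedAddCommGroup F] [NormedSpace ℝ F]
  {ψ : (Fin N → ℝ) → (Fin N → ℝ)} {O U : Set (Fin N → ℝ)}

/-- The Jacobian matrix `∂ψⁱ/∂xᵃ`. -/
noncomputable def jac (ψ : (Fin N → ℝ) → (Fin N → ℝ)) (a i : Fin N) (x : Fin N → ℝ) : ℝ :=
  pd a (fun y => ψ y i) x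

theorem contDiffOn_component (hψ : ContDiffOn ℝ ∞ ψ O) (i : Fin N) :
    ContDiffOn ℝ ∞ (fun y => ψ y i) O := contDiffOn_pi.1 hψ i

theorem contDiffOn_jac (hO : IsOpen O) (hψ : ContDiffOn ℝ ∞ ψ O) (a i : Fin N) :
    ContDiffOn ℝ ∞ (jac ψ a i) O := contDiffOn_pd hO (contDiffOn_component hψ i) a

theorem pd_comp {h : (Fin N → ℝ) → F} {x : Fin N → ℝ} (hh : DifferentiableAt ℝ h (ψ x))
    (hψ : DifferentiableAt ℝ ψ x) (a : Fin N) :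
    pd a (fun y => h (ψ y)) x = ∑ i, jac ψ a i x • pd i h (ψ x) := by
  have h1 : HasFDerivAt (fun y => h (ψ y)) (fderiv ℝ h (ψ x) ∘L fderiv ℝ ψ x) x :=
    hh.hasFDerivAt.comp x hψ.hasFDerivAt
  rw [h1.pd_eq, ContinuousLinearMap.comp_apply, fderiv_eq_sum_pd]
  refine Finset.sum_congr rfl fun i _ => ?_
  congr 1
  exact ((hasFDerivAt_pi'.1 hψ.hasFDerivAt i).pd_eq a).symm

/-- The functions `Γ` are the Christoffel symbols at `ψ x` of a connection for which the
coordinates `x` are flat. -/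
def IsFlatChart (Γ : Fin N → Fin N → Fin N → (Fin N → ℝ) → ℝ) (ψ : (Fin N → ℝ) → (Fin N → ℝ))
    (O : Set (Fin N → ℝ)) : Prop :=
  ∀ x ∈ O, ∀ a b t, pd a (jac ψ b t) x =
    -∑ j, ∑ k, Γ t j k (ψ x) * (jac ψ a j x * jac ψ b k x)

variable {Γ : Fin N → Fin N → Fin N → (Fin N → ℝ) → ℝ}

/-- The derivative of the components of a covector field in flat coordinates is given by its
covariant derivative. -/
theorem IsFlatChart.pd_covector (hΓ : IsFlatChart Γ ψ O) (hO : IsOpen O)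
    (hψ : ContDiffOn ℝ ∞ ψ O) (hU : IsOpen U) (hm : MapsTo ψ O U) {h : Fin N → (Fin N → ℝ) → F}
    (hh : ∀ k, ContDiffOn ℝ ∞ (h k) U) {x : Fin N → ℝ} (hx : x ∈ O) (b c : Fin N) :
    pd b (fun y => ∑ k, jac ψ c k y • h k (ψ y)) x =
      ∑ j, ∑ k, (jac ψ b j x * jac ψ c k x) •
        (pd j (h k) (ψ x) - ∑ t, Γ t j k (ψ x) • h t (ψ x)) := by
  have hdψ := differentiableAt_of_contDiffOn hO hψ hx
  have hdJ : ∀ a i, DifferentiableAt ℝ (jac ψ a i) x := fun a i =>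
    differentiableAt_of_contDiffOn hO (contDiffOn_jac hO hψ a i) hx
  have hdh : ∀ k, DifferentiableAt ℝ (h k) (ψ x) := fun k =>
    differentiableAt_of_contDiffOn hU (hh k) (hm hx)
  have hdc : ∀ k, DifferentiableAt ℝ (fun y => h k (ψ y)) x := fun k => (hdh k).comp x hdψ
  rw [pd_sum fun k => (hdJ c k).fun_smul (hdc k)]
  simp only [fun k => pd_smul (hdJ c k) (hdc k) b, pd_comp (hdh _) hdψ, hΓ x hx b c,
    smul_sub, Finset.sum_sub_distrib, Finset.sum_add_distrib, Finset.smul_sum, smul_smul, neg_smul,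
    Finset.sum_neg_distrib, Finset.sum_smul]
  rw [neg_add_eq_sub]
  congr 1
  · rw [Finset.sum_comm]
    refine Finset.sum_congr rfl fun j _ => Finset.sum_congr rfl fun k _ => ?_
    rw [mul_comm]
  · rw [Finset.sum_comm]
    refine Finset.sum_congr rfl fun j _ => ?_
    rw [Finset.sum_comm]
    refine Finset.sum_congr rfl fun k _ => Finset.sum_congr rfl fun t _ => ?_
    rw [mul_comm]

/-- The derivative of the components of a covariant 2-tensor in flat coordinates is given by its
covariant derivative. -/
theorem IsFlatChart.pd_tensor (hΓ : IsFlatChart Γ ψ O) (hO : IsOpen O)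
    (hψ : ContDiffOn ℝ ∞ ψ O) (hU : IsOpen U) (hm : MapsTo ψ O U)
    {h : Fin N → Fin N → (Fin N → ℝ) → ℝ}
    (hh : ∀ j k, ContDiffOn ℝ ∞ (h j k) U) {x : Fin N → ℝ} (hx : x ∈ O) (a b c : Fin N) :
    pd a (fun y => ∑ j, ∑ k, jac ψ b j y * jac ψ c k y * h j k (ψ y)) x =
      ∑ i, ∑ j, ∑ k, jac ψ a i x * jac ψ b j x * jac ψ c k x * (pd i (h j k) (ψ x) -
        ∑ m, (Γ m i j (ψ x) * h m k (ψ x) + Γ m i k (ψ x) * h j m (ψ x))) := by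
  have hdψ := differentiableAt_of_contDiffOn hO hψ hx
  have hdJ : ∀ a i, DifferentiableAt ℝ (jac ψ a i) x := fun a i =>
    differentiableAt_of_contDiffOn hO (contDiffOn_jac hO hψ a i) hx
  have hdh : ∀ j k, DifferentiableAt ℝ (h j k) (ψ x) := fun j k =>
    differentiableAt_of_contDiffOn hU (hh j k) (hm hx)
  have hdc : ∀ j k, DifferentiableAt ℝ (fun y => h j k (ψ y)) x := fun j k => (hdh j k).comp x hdψ
  have hJJ : ∀ j k, DifferentiableAt ℝ (fun y => jac ψ b j y * jac ψ c k y) x := fun j k =>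
    (hdJ b j).fun_mul (hdJ c k)
  rw [pd_sum fun j => DifferentiableAt.fun_sum fun k _ => (hJJ j k).fun_mul (hdc j k)]
  simp only [fun j => pd_sum (u := x) (fun k => (hJJ j k).fun_mul (hdc j k)) a,
    fun j k => pd_mul (hJJ j k) (hdc j k) a, fun j k => pd_mul (hdJ b j) (hdJ c k) a,
    fun j k => pd_comp (hdh j k) hdψ a, smul_eq_mul, hΓ x hx]
  -- Both sides are split into a derivative term and one Christoffel term per tensor slot; the three
  -- sums are then matched by reindexing.
  have e1 : ∀ P Q R T : ℝ, P * (Q - (R + T)) = P * Q - P * R - P * T := fun P Q R T => by ring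
  have e2 : ∀ A C J K h D : ℝ, (-A * K + J * -C) * h + J * K * D =
    J * K * D - A * K * h - J * C * h := fun A C J K h D => by ring
  simp only [Finset.sum_add_distrib, e1, e2, Finset.sum_sub_distrib]
  congr 1
  · congr 1
    · simp only [Finset.mul_sum]
      conv_lhs => enter [2, j]; rw [Finset.sum_comm]
      rw [Finset.sum_comm]
      refine Finset.sum_congr rfl fun i _ => Finset.sum_congr rfl fun j _ =>
        Finset.sum_congr rfl fun k _ => ?_
      ring
    · simp only [Finset.mul_sum, Finset.sum_mul]
      conv_lhs => enter [2, j]; rw [Finset.sum_comm]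
      rw [Finset.sum_comm]
      refine Finset.sum_congr rfl fun i _ => ?_
      conv_lhs => enter [2, j]; rw [Finset.sum_comm]
      rw [Finset.sum_comm]
      refine Finset.sum_congr rfl fun l _ => ?_
      rw [Finset.sum_comm]
      refine Finset.sum_congr rfl fun k _ => Finset.sum_congr rfl fun m _ => ?_
      ring
  · simp only [Finset.mul_sum, Finset.sum_mul]
    conv_lhs => enter [2, j]; rw [Finset.sum_comm]
    rw [Finset.sum_comm]
    refine Finset.sum_congr rfl fun i _ => Finset.sum_congr rfl fun j _ => ?_
    rw [Finset.sum_comm]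
    refine Finset.sum_congr rfl fun k _ => Finset.sum_congr rfl fun m _ => ?_
    ring

end Pullback

/-- A smooth inverse, defined on a ball, of a smooth map with identity derivative at a point. -/
theorem exists_smooth_local_inverse {E : Type*} [NormedAddCommGroup E] [NormedSpace ℝ E]
    [CompleteSpace E] {f : E → E} {U : Set E} (hU : IsOpen U) (hf : ContDiffOn ℝ ∞ f U) {p : E}
    (hp : p ∈ U) (hd : HasFDerivAt f (ContinuousLinearMap.id ℝ E) p) :
    ∃ e : OpenPartialHomeomorph E E, p ∈ e.target ∧ e.target ⊆ U ∧ ContDiffOn ℝ ∞ e e.source ∧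
      ContDiffOn ℝ ∞ e.symm e.target ∧ (∀ u ∈ e.target, e.symm u = f u) ∧
      IsPreconnected e.source := by
  have hfp : ContDiffAt ℝ ∞ f p := hf.contDiffAt (hU.mem_nhds hp)
  have hd' : HasFDerivAt f ((ContinuousLinearEquiv.refl ℝ E : E ≃L[ℝ] E) : E →L[ℝ] E) p := hd
  let φ := hfp.toOpenPartialHomeomorph f hd' (by simp)
  have hpφ : p ∈ φ.source := hfp.mem_toOpenPartialHomeomorph_source hd' (by simp)
  have hφ : ∀ u, φ u = f u := fun u => rfl
  have hcont : ContinuousOn (fderiv ℝ f) U := hf.continuousOn_fderiv_of_isOpen hU (by simp)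
  -- On this set the derivative stays invertible, which gives smoothness of the inverse at every
  -- point and not only at the image of p.
  let I : Set E := U ∩ fderiv ℝ f ⁻¹' {L | IsUnit L}
  have hI : IsOpen I := hcont.isOpen_inter_preimage hU Units.isOpen
  have hpI : p ∈ I := ⟨hp, by rw [mem_preimage, hd.fderiv]; exact isUnit_one⟩
  let φ₁ := φ.restrOpen I hI
  have hpφ₁ : p ∈ φ₁.source := by
    rw [OpenPartialHomeomorph.restrOpen_source]
    exact ⟨hpφ, hpI⟩
  obtain ⟨ε, hε, hεs⟩ := Metric.isOpen_iff.1 φ₁.open_target (φ₁ p) (φ₁.map_source hpφ₁)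
  -- The chart is the inverse of f, cut down to a ball so that its source is connected.
  let e := φ₁.symm.restrOpen (ball (φ₁ p) ε) isOpen_ball
  have hes : e.source = ball (φ₁ p) ε := by
    rw [OpenPartialHomeomorph.restrOpen_source]
    exact inter_eq_right.2 hεs
  have het : ∀ u ∈ e.target, u ∈ φ₁.source := fun u hu => by
    have h1 : e.symm u ∈ φ₁.target := hεs (by rw [← hes]; exact e.map_target hu)
    have h2 : u = φ₁.symm (e.symm u) := (e.right_inv hu).symm
    rw [h2]
    exact φ₁.map_target h1
  have hetI : ∀ u ∈ e.target, u ∈ I := fun u hu => by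
    have := het u hu
    rw [OpenPartialHomeomorph.restrOpen_source] at this
    exact this.2
  have hsymm : ∀ u, e.symm u = f u := fun u => rfl
  refine ⟨e, ?_, fun u hu => (hetI u hu).1, ?_, ?_, fun u _ => hsymm u, ?_⟩
  · have h1 : e (φ₁ p) = p := φ₁.left_inv hpφ₁
    rw [← h1]
    exact e.map_source (by rw [hes]; exact mem_ball_self hε)
  · intro x hx
    have hxt : e x ∈ e.target := e.map_source hx
    obtain ⟨L, hL⟩ := (hetI _ hxt).2
    have hfx : ContDiffAt ℝ ∞ f (e x) := hf.contDiffAt (hU.mem_nhds (hetI _ hxt).1)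
    have hD : HasFDerivAt f ((ContinuousLinearEquiv.ofUnit L : E ≃L[ℝ] E) : E →L[ℝ] E) (e x) := by
      have h2 : ((ContinuousLinearEquiv.ofUnit L : E ≃L[ℝ] E) : E →L[ℝ] E) = fderiv ℝ f (e x) := hL
      rw [h2]
      exact (hfx.differentiableAt (by simp)).hasFDerivAt
    exact (e.symm.contDiffAt_symm (a := x) hx hD hfx).contDiffWithinAt
  · exact fun u hu => ((hf u (hetI u hu).1).mono fun v hv => (hetI v hv).1)
  · rw [hes]
    exact (convex_ball _ _).isPreconnected

/-! ### Christoffel symbols of a submanifold. -/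

section Christoffel

variable {N : ℕ} {W : Set (Fin N → ℝ)} {g : (Fin N → ℝ) → Matrix (Fin N) (Fin N) ℝ}

theorem contDiffOn_det {M : (Fin N → ℝ) → Matrix (Fin N) (Fin N) ℝ}
    (hM : ∀ i j, ContDiffOn ℝ ∞ (fun u => M u i j) W) : ContDiffOn ℝ ∞ (fun u => (M u).det) W := by
  simp only [Matrix.det_apply]
  exact ContDiffOn.sum fun σ _ => (contDiffOn_prod fun i _ => hM _ _).const_smul _

/-- Cramer's rule: an entry of the inverse is a cofactor over the determinant, both polynomial in
the entries of g. -/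
theorem contDiffOn_inv_entry (hg : ∀ i j, ContDiffOn ℝ ∞ (fun u => g u i j) W)
    (hdet : ∀ u ∈ W, (g u).det ≠ 0) (i j : Fin N) : ContDiffOn ℝ ∞ (fun u => (g u)⁻¹ i j) W := by
  have h : ∀ u ∈ W, (g u)⁻¹ i j = ((g u).det)⁻¹ * (g u).adjugate i j := fun u hu => by
    rw [Matrix.inv_def, Matrix.smul_apply, Ring.inverse_eq_inv', smul_eq_mul]
  refine ContDiffOn.congr (ContDiffOn.mul ((contDiffOn_det hg).inv hdet) ?_) h
  simp only [Matrix.adjugate_apply]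
  refine contDiffOn_det fun a b => ?_
  by_cases hab : a = j
  · subst hab
    simp only [Matrix.updateRow_self]
    exact contDiffOn_const
  · simp only [Matrix.updateRow_ne hab]
    exact hg a b

theorem contDiffOn_christoffel (hW : IsOpen W) (hg : ∀ i j, ContDiffOn ℝ ∞ (fun u => g u i j) W)
    (hdet : ∀ u ∈ W, (g u).det ≠ 0) (k i j : Fin N) : ContDiffOn ℝ ∞ (christoffel g k i j) W := by
  unfold christoffel
  exact contDiffOn_const.mul (ContDiffOn.sum fun l _ => (contDiffOn_inv_entry hg hdet k l).mul
    (((contDiffOn_pd hW (hg _ _) _).add (contDiffOn_pd hW (hg _ _) _)).sub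
      (contDiffOn_pd hW (hg _ _) _)))

theorem christoffel_comm (hg : ∀ u, (g u).IsSymm) (k i j : Fin N) (u : Fin N → ℝ) :
    christoffel g k i j u = christoffel g k j i u := by
  have h : (fun v => g v i j) = fun v => g v j i := funext fun v => (hg v).apply j i
  simp only [christoffel, h, add_comm]

variable {V : Type*} [NormedAddCommGroup V] [NormedSpace ℝ V] [FiniteDimensional ℝ V]
  {B : LinearMap.BilinForm ℝ V} {r : (Fin N → ℝ) → V}

theorem contDiffOn_firstForm (hW : IsOpen W) (hr : ContDiffOn ℝ ∞ r W) (i j : Fin N) :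
    ContDiffOn ℝ ∞ (fun u => firstForm B r u i j) W :=
  contDiffOn_bilin B (contDiffOn_pd hW hr i) (contDiffOn_pd hW hr j)

/-- The normal part of `r_{uⁱuʲ}` is `r_{uⁱuʲ} - Γᵗ_{ij} r_{uᵗ}`. -/
theorem bilin_second_sub_christoffel (hB : B.IsSymm) (hW : IsOpen W) (hr : ContDiffOn ℝ ∞ r W)
    {u : Fin N → ℝ} (hu : u ∈ W) (hdet : (firstForm B r u).det ≠ 0) (i j k : Fin N) :
    B (pd i (pd j r) u - ∑ t, christoffel (firstForm B r) t i j u • pd t r u) (pd k r u) = 0 := by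
  have hd : ∀ i, DifferentiableAt ℝ (pd i r) u := fun i =>
    differentiableAt_of_contDiffOn hW (contDiffOn_pd hW hr i) hu
  have hpd : ∀ a i j, pd a (fun v => firstForm B r v i j) u =
      B (pd a (pd i r) u) (pd j r u) + B (pd i r u) (pd a (pd j r) u) := fun a i j =>
    pd_bilin B (hd i) (hd j) a
  -- The Koszul combination: by symmetry of second derivatives all terms but two copies of
  -- (r_{uⁱuʲ}, r_{uˡ}) cancel.
  have hG : ∀ l, pd i (fun v => firstForm B r v j l) u + pd j (fun v => firstForm B r v i l) u -
      pd l (fun v => firstForm B r v i j) u = 2 * B (pd i (pd j r) u) (pd l r u) := fun l => by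
    rw [hpd, hpd, hpd, pd_comm hW hr hu j i, pd_comm hW hr hu l i, pd_comm hW hr hu l j,
      show B (pd i (pd l r) u) (pd j r u) = B (pd j r u) (pd i (pd l r) u) from hB.eq _ _]
    ring
  have hinv : (firstForm B r u).mulVec ((firstForm B r u)⁻¹.mulVec
      fun l => B (pd i (pd j r) u) (pd l r u)) = fun l => B (pd i (pd j r) u) (pd l r u) := by
    rw [Matrix.mulVec_mulVec, Matrix.mul_nonsing_inv _ (isUnit_iff_ne_zero.2 hdet),
      Matrix.one_mulVec]
  have hc : ∀ t, christoffel (firstForm B r) t i j u =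
      ((firstForm B r u)⁻¹.mulVec fun l => B (pd i (pd j r) u) (pd l r u)) t := fun t => by
    simp only [christoffel, hG, Matrix.mulVec, dotProduct, Finset.mul_sum]
    exact Finset.sum_congr rfl fun l _ => by ring
  have h := congrFun hinv k
  rw [Matrix.mulVec, dotProduct] at h
  rw [map_sub, LinearMap.sub_apply, sub_eq_zero, ← h, map_sum, LinearMap.sum_apply]
  refine Finset.sum_congr rfl fun t _ => ?_
  rw [map_smul, LinearMap.smul_apply, smul_eq_mul, hc, mul_comm]
  congr 1
  exact hB.eq _ _

end Christoffel

/-! ### Flat coordinates of a metric with zero curvature. -/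

section FlatChart

variable {N : ℕ} {W : Set (Fin N → ℝ)} {g : (Fin N → ℝ) → Matrix (Fin N) (Fin N) ℝ}

/-- A flat metric has flat coordinates near each point. -/
theorem exists_flatChart (hW : IsOpen W) (hgs : ∀ u, (g u).IsSymm)
    (hg : ∀ i j, ContDiffOn ℝ ∞ (fun u => g u i j) W) (hdet : ∀ u ∈ W, (g u).det ≠ 0)
    (hflat : ∀ u ∈ W, ∀ l k i j, riemann g l k i j u = 0) {p : Fin N → ℝ} (hp : p ∈ W) :
    ∃ e : OpenPartialHomeomorph (Fin N → ℝ) (Fin N → ℝ), p ∈ e.target ∧ e.target ⊆ W ∧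
      ContDiffOn ℝ ∞ e e.source ∧ ContDiffOn ℝ ∞ e.symm e.target ∧ IsPreconnected e.source ∧
      IsFlatChart (christoffel g) e e.source ∧
      ∀ x ∈ e.source, (Matrix.of fun a i => jac e a i x).det ≠ 0 := by
  obtain ⟨ε, hε, hεW⟩ := Metric.isOpen_iff.1 hW p hp
  have hsc : IsSimplyConnected (ball p ε) := by
    have := (convex_ball p ε).contractibleSpace ⟨p, mem_ball_self hε⟩
    exact SimplyConnectedSpace.ofContractible _
  have hΓ := contDiffOn_christoffel hW hg hdet
  -- The system ∂ᵢX_j = Γᵏ_{ij}X_k in ℝᴺ describes N parallel covector fields. Its integrability is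
  -- the vanishing of the curvature; the symmetry of Γ makes the covectors closed, so they are
  -- differentials of N functions f. The initial value makes df the identity at p.
  obtain ⟨f, X, hX0, hf, hXs, hfX, hX⟩ := exists_frame_and_primitive (V := Fin N → ℝ)
    (A := fun i u j k => christoffel g k i j u) isOpen_ball hsc
    (fun j s t => (hΓ t j s).mono hεW)
    (fun u hu i j s t => by
      have h := hflat u (hεW hu) t s i j
      rw [riemann, Finset.sum_sub_distrib] at h
      have e1 : ∀ i j, ∑ q, christoffel g q j s u * christoffel g t i q u =
          ∑ m, christoffel g t i m u * christoffel g m j s u := fun i j =>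
        Finset.sum_congr rfl fun q _ => mul_comm _ _
      rw [e1, e1]
      change pd i (christoffel g t j s) u + _ = pd j (christoffel g t i s) u + _
      linarith)
    id (fun u hu i j t => christoffel_comm hgs t i j u) (mem_ball_self hε)
    (fun a => Pi.single a (1 : ℝ))
  have hfd : HasFDerivAt f (ContinuousLinearMap.id ℝ (Fin N → ℝ)) p := by
    have h1 := (differentiableAt_of_contDiffOn isOpen_ball hf (mem_ball_self hε)).hasFDerivAt
    have h2 : fderiv ℝ f p = ContinuousLinearMap.id ℝ (Fin N → ℝ) := by
      ext1 a
      rw [fderiv_eq_sum_pd]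
      simp only [hfX p (mem_ball_self hε), id, hX0]
      ext i
      simp [Pi.single_apply]
    rwa [h2] at h1
  obtain ⟨e, hpe, het, hes, hes', hef, hec⟩ :=
    exists_smooth_local_inverse isOpen_ball hf (mem_ball_self hε) hfd
  have hmap : MapsTo e e.source (ball p ε) := fun x hx => het (e.map_source hx)
  have hed : ∀ x ∈ e.source, DifferentiableAt ℝ e x := fun x hx =>
    differentiableAt_of_contDiffOn e.open_source hes hx
  -- The chain rule for f ∘ e = id. Differentiating this constant once more yields the equation of a
  -- flat chart, since the X_k are independent.
  have hone : ∀ x ∈ e.source, ∀ b, ∑ k, jac e b k x • X k (e x) = Pi.single b (1 : ℝ) := by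
    intro x hx b
    have hid : ∀ y ∈ e.source, f (e y) = y := fun y hy => by
      rw [← hef _ (e.map_source hy), e.left_inv hy]
    have h1 := pd_comp (differentiableAt_of_contDiffOn isOpen_ball hf (hmap hx)) (hed x hx) b
    rw [pd_congr e.open_source hid hx] at h1
    simp only [hfX _ (hmap hx), id] at h1
    rw [← h1]
    simp [pd]
  have hli : ∀ x ∈ e.source, LinearIndependent ℝ fun k => X k (e x) := by
    intro x hx
    refine linearIndependent_of_top_le_span_of_card_eq_finrank (fun v _ => ?_) (by simp)
    rw [← Finset.univ_sum_single v]
    refine Submodule.sum_mem _ fun b _ => ?_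
    have h2 : (Pi.single b (v b) : Fin N → ℝ) = v b • Pi.single b (1 : ℝ) := by
      rw [← Pi.single_smul', smul_eq_mul, mul_one]
    rw [h2, ← hone x hx b]
    exact Submodule.smul_mem _ _ (Submodule.sum_mem _ fun k _ => Submodule.smul_mem _ _
      (Submodule.subset_span ⟨k, rfl⟩))
  refine ⟨e, hpe, het.trans hεW, hes, hes', hec, fun x hx a b t => ?_, fun x hx => ?_⟩
  · have hdJ : ∀ a i, DifferentiableAt ℝ (jac e a i) x := fun a i =>
      differentiableAt_of_contDiffOn e.open_source (contDiffOn_jac e.open_source hes a i) hx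
    have hdX : ∀ k, DifferentiableAt ℝ (X k) (e x) := fun k =>
      differentiableAt_of_contDiffOn isOpen_ball (hXs k) (hmap hx)
    have hdc : ∀ k, DifferentiableAt ℝ (fun y => X k (e y)) x := fun k => (hdX k).comp x (hed x hx)
    have h1 := pd_congr (f := fun y => ∑ k, jac e b k y • X k (e y))
      (g := fun _ => (Pi.single b (1 : ℝ) : Fin N → ℝ)) e.open_source (fun y hy => hone y hy b) hx a
    rw [pd_const, pd_sum fun k => (hdJ b k).fun_smul (hdc k)] at h1
    simp only [fun k => pd_smul (hdJ b k) (hdc k) a, pd_comp (hdX _) (hed x hx),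
      hX _ (hmap hx), Finset.sum_add_distrib, Finset.smul_sum, smul_smul] at h1
    have h2 : ∑ k, ∑ j, ∑ t, (jac e b k x * (jac e a j x * christoffel g t j k (e x))) • X t (e x) =
        ∑ t, (∑ j, ∑ k, christoffel g t j k (e x) * (jac e a j x * jac e b k x)) • X t (e x) := by
      simp only [Finset.sum_smul]
      rw [Finset.sum_comm]
      conv_lhs => enter [2, j]; rw [Finset.sum_comm]
      rw [Finset.sum_comm]
      refine Finset.sum_congr rfl fun t _ => Finset.sum_congr rfl fun j _ =>
        Finset.sum_congr rfl fun k _ => ?_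
      congr 1
      ring
    rw [h2, ← Finset.sum_add_distrib] at h1
    simp only [← add_smul] at h1
    exact eq_neg_of_add_eq_zero_left (Fintype.linearIndependent_iff.1 (hli x hx) _ h1 t)
  · have hmul : (Matrix.of fun a i => jac e a i x) * (Matrix.of fun k i => X k (e x) i) = 1 := by
      ext b i
      have h := congrFun (hone x hx b) i
      rw [Finset.sum_apply] at h
      rw [Matrix.mul_apply, Matrix.one_apply]
      simpa [Pi.single_apply, eq_comm] using h
    exact fun h0 => by simpa [h0] using congrArg Matrix.det hmul

end FlatChart

/-! ### A potential submanifold in flat coordinates. -/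

section FlatCoordinates

variable {N : ℕ} {V : Type*} [NormedAddCommGroup V] [NormedSpace ℝ V]
  {B : LinearMap.BilinForm ℝ V} {r : (Fin N → ℝ) → V} {n : Fin N → (Fin N → ℝ) → V}
  {Φ : (Fin N → ℝ) → ℝ} {ψ : (Fin N → ℝ) → (Fin N → ℝ)} {O W : Set (Fin N → ℝ)}

theorem linearIndependent_jac_smul {v : Fin N → V} (hv : LinearIndependent ℝ v) {x : Fin N → ℝ}
    (hJ : (Matrix.of fun a i => jac ψ a i x).det ≠ 0) :
    LinearIndependent ℝ fun a => ∑ i, jac ψ a i x • v i := by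
  rw [Fintype.linearIndependent_iff] at hv ⊢
  intro c hc
  have h : Matrix.vecMul c (Matrix.of fun a i => jac ψ a i x) = 0 := by
    refine funext fun i => hv _ ?_ i
    rw [← hc]
    simp only [Matrix.vecMul, dotProduct, Matrix.of_apply, Finset.sum_smul, Finset.smul_sum,
      smul_smul]
    exact Finset.sum_comm
  exact congrFun (Matrix.eq_zero_of_vecMul_eq_zero hJ h)

theorem pd_comp_smooth {F : Type*} [NormedAddCommGroup F] [NormedSpace ℝ F]
    {h : (Fin N → ℝ) → F} (hO : IsOpen O) (hψ : ContDiffOn ℝ ∞ ψ O) (hW : IsOpen W)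
    (hm : MapsTo ψ O W) (hh : ContDiffOn ℝ ∞ h W) {x : Fin N → ℝ} (hx : x ∈ O) (a : Fin N) :
    pd a (h ∘ ψ) x = ∑ i, jac ψ a i x • pd i h (ψ x) :=
  pd_comp (differentiableAt_of_contDiffOn hW hh (hm hx)) (differentiableAt_of_contDiffOn hO hψ hx) a

theorem IsFlatChart.pd_pd_comp {F : Type*} [NormedAddCommGroup F] [NormedSpace ℝ F]
    {Γ : Fin N → Fin N → Fin N → (Fin N → ℝ) → ℝ} {h : (Fin N → ℝ) → F} (hΓ : IsFlatChart Γ ψ O)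
    (hO : IsOpen O) (hψ : ContDiffOn ℝ ∞ ψ O) (hW : IsOpen W)
    (hm : MapsTo ψ O W) (hh : ContDiffOn ℝ ∞ h W) {x : Fin N → ℝ} (hx : x ∈ O) (b c : Fin N) :
    pd b (pd c (h ∘ ψ)) x = ∑ j, ∑ k, (jac ψ b j x * jac ψ c k x) •
      (pd j (pd k h) (ψ x) - ∑ t, Γ t j k (ψ x) • pd t h (ψ x)) := by
  rw [← hΓ.pd_covector hO hψ hW hm (h := fun k => pd k h) (fun k => contDiffOn_pd hW hh k) hx]
  exact pd_congr hO (fun y hy => pd_comp_smooth hO hψ hW hm hh hy c) hx b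

/-- The third derivatives in flat coordinates are the components of the third covariant
differential. -/
theorem IsFlatChart.pd_pd_pd_comp {g : (Fin N → ℝ) → Matrix (Fin N) (Fin N) ℝ}
    (hΓ : IsFlatChart (christoffel g) ψ O) (hO : IsOpen O) (hψ : ContDiffOn ℝ ∞ ψ O)
    (hW : IsOpen W) (hm : MapsTo ψ O W) (hg : ∀ i j, ContDiffOn ℝ ∞ (fun u => g u i j) W)
    (hdet : ∀ u ∈ W, (g u).det ≠ 0) (hΦ : ContDiffOn ℝ ∞ Φ W) {x : Fin N → ℝ} (hx : x ∈ O)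
    (a b c : Fin N) : pd a (pd b (pd c (Φ ∘ ψ))) x =
      ∑ i, ∑ j, ∑ k, jac ψ a i x * jac ψ b j x * jac ψ c k x * cov3 g Φ i j k (ψ x) := by
  have h2 : ∀ j k, ContDiffOn ℝ ∞ (cov2 g Φ j k) W := fun j k =>
    (contDiffOn_pd hW (contDiffOn_pd hW hΦ k) j).sub (ContDiffOn.sum fun m _ =>
      (contDiffOn_christoffel hW hg hdet m j k).mul (contDiffOn_pd hW hΦ m))
  refine (pd_congr hO (fun y hy => hΓ.pd_pd_comp hO hψ hW hm hΦ hy b c) hx a).trans ?_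
  exact hΓ.pd_tensor hO hψ hW hm h2 hx a b c

variable [FiniteDimensional ℝ V] (hB : B.IsSymm) (hO : IsOpen O) (hψ : ContDiffOn ℝ ∞ ψ O)
  (hW : IsOpen W) (hm : MapsTo ψ O W) (hΓ : IsFlatChart (christoffel (firstForm B r)) ψ O)
  (hr : IsSubmanifold B W r)
include hB hO hψ hW hm hΓ hr

/-- In a flat chart the second derivatives of r are Jacobian combinations of the vectors r_{uʲuᵏ} -
Γᵗ_{jk} r_{uᵗ}, which are normal. Hence the metric is constant in this chart. -/
theorem bilin_pd_pd_comp_eq_zero {x : Fin N → ℝ} (hx : x ∈ O) (a b c : Fin N) :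
    B (pd b (pd c (r ∘ ψ)) x) (pd a (r ∘ ψ) x) = 0 := by
  rw [hΓ.pd_pd_comp hO hψ hW hm hr.smooth hx, pd_comp_smooth hO hψ hW hm hr.smooth hx, map_sum]
  refine Finset.sum_eq_zero fun i _ => ?_
  simp only [map_sum, map_smul, LinearMap.sum_apply, LinearMap.smul_apply,
    bilin_second_sub_christoffel hB hW hr.smooth (hm hx) (hr.nonisotropic _ (hm hx)), smul_zero,
    Finset.sum_const_zero]

theorem firstForm_comp_eq (hc : IsPreconnected O) {x q : Fin N → ℝ} (hx : x ∈ O) (hq : q ∈ O) :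
    firstForm B (r ∘ ψ) x = firstForm B (r ∘ ψ) q := by
  have hs : ContDiffOn ℝ ∞ (r ∘ ψ) O := hr.smooth.comp hψ hm
  have hd : ∀ y ∈ O, ∀ i, DifferentiableAt ℝ (pd i (r ∘ ψ)) y := fun y hy i =>
    differentiableAt_of_contDiffOn hO (contDiffOn_pd hO hs i) hy
  ext i j
  refine eq_of_pd_eq_zero hO hc (f := fun y => B (pd i (r ∘ ψ) y) (pd j (r ∘ ψ) y))
    (fun y hy => differentiableAt_bilin B (hd y hy i) (hd y hy j)) (fun y hy a => ?_) hx hq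
  rw [pd_bilin B (hd y hy i) (hd y hy j), bilin_pd_pd_comp_eq_zero hB hO hψ hW hm hΓ hr hy,
    show B (pd i (r ∘ ψ) y) (pd a (pd j (r ∘ ψ)) y) = B (pd a (pd j (r ∘ ψ)) y) (pd i (r ∘ ψ) y)
      from hB.eq _ _, bilin_pd_pd_comp_eq_zero hB hO hψ hW hm hΓ hr hy, add_zero]

omit hB hΓ [FiniteDimensional ℝ V] in
theorem isSubmanifold_comp (hJ : ∀ x ∈ O, (Matrix.of fun a i => jac ψ a i x).det ≠ 0) :
    IsSubmanifold B O (r ∘ ψ) := by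
  have hpd : ∀ x ∈ O, ∀ a, pd a (r ∘ ψ) x = ∑ i, jac ψ a i x • pd i r (ψ x) := fun x hx a =>
    pd_comp_smooth hO hψ hW hm hr.smooth hx a
  refine ⟨hr.smooth.comp hψ hm, fun x hx => ?_, fun x hx => ?_⟩
  · simp only [hpd x hx]
    exact linearIndependent_jac_smul (hr.rank _ (hm hx)) (hJ x hx)
  · have h : firstForm B (r ∘ ψ) x = (Matrix.of fun a i => jac ψ a i x) * firstForm B r (ψ x) *
        (Matrix.of fun a i => jac ψ a i x).transpose := by
      ext a b
      simp only [firstForm, Matrix.of_apply, hpd x hx, map_sum, map_smul, LinearMap.sum_apply,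
        LinearMap.smul_apply, smul_eq_mul, Matrix.mul_apply, Matrix.transpose_apply,
        Finset.mul_sum, Finset.sum_mul]
      refine Finset.sum_congr rfl fun i _ => Finset.sum_congr rfl fun j _ => ?_
      ring
    rw [h, Matrix.det_mul, Matrix.det_mul, Matrix.det_transpose]
    exact mul_ne_zero (mul_ne_zero (hJ x hx) (hr.nonisotropic _ (hm hx))) (hJ x hx)

/-- In flat coordinates a potential flat torsionless submanifold has the fundamental forms given by
the potential. -/
theorem hasFundamentalForms_comp (hc : IsPreconnected O)
    (hJ : ∀ x ∈ O, (Matrix.of fun a i => jac ψ a i x).det ≠ 0) (hP : IsPotential B W r n Φ)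
    {q : Fin N → ℝ} (hq : q ∈ O) :
    HasFundamentalForms B (firstForm B (r ∘ ψ) q)
      (Matrix.of fun a b => B (∑ i, jac ψ a i q • n i (ψ q)) (∑ i, jac ψ b i q • n i (ψ q))) O
      (r ∘ ψ) (fun a x => ∑ i, jac ψ a i x • n i (ψ x)) (Φ ∘ ψ) := by
  have hns : ∀ a, ContDiffOn ℝ ∞ (fun x => ∑ i, jac ψ a i x • n i (ψ x)) O := fun a =>
    ContDiffOn.sum fun i _ => (contDiffOn_jac hO hψ a i).smul ((hP.frame.smooth i).comp hψ hm)
  have hdn : ∀ x ∈ O, ∀ a, DifferentiableAt ℝ (fun x => ∑ i, jac ψ a i x • n i (ψ x)) x :=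
    fun x hx a => differentiableAt_of_contDiffOn hO (hns a) hx
  have htor : ∀ x ∈ O, ∀ i j k,
      torsionCoeff B (fun a x => ∑ i, jac ψ a i x • n i (ψ x)) i j k x = 0 := by
    intro x hx a b c
    rw [torsionCoeff, hΓ.pd_covector hO hψ hW hm hP.frame.smooth hx, map_sum]
    refine Finset.sum_eq_zero fun l _ => ?_
    -- This is the parallelism of the covariantly labelled frame, with the lower indices of Γ
    -- exchanged.
    have h : ∀ j k, B (pd j (n k) (ψ x) - ∑ t, christoffel (firstForm B r) t j k (ψ x) • n t (ψ x))
        (n l (ψ x)) = 0 := fun j k => by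
      have := hP.parallel _ (hm hx) k j l
      rw [torsionCoeff] at this
      simp only [map_sub, map_sum, map_smul, LinearMap.sub_apply, LinearMap.sum_apply,
        LinearMap.smul_apply, smul_eq_mul, this]
      rw [sub_eq_zero]
      refine Finset.sum_congr rfl fun t _ => ?_
      rw [christoffel_comm (fun u => isSymm_firstForm hB u)]
    simp only [map_sum, map_smul, LinearMap.sum_apply, LinearMap.smul_apply, h, smul_zero,
      Finset.sum_const_zero]
  refine ⟨isSubmanifold_comp hO hψ hW hm hr hJ, ⟨hns, fun x hx a i => ?_, fun x hx => ?_⟩,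
    fun x hx => firstForm_comp_eq hB hO hψ hW hm hΓ hr hc hx hq, fun x hx i j => ?_, htor,
    fun x hx a b c => ?_⟩
  · rw [pd_comp_smooth hO hψ hW hm hr.smooth hx]
    simp only [map_sum, map_smul, LinearMap.sum_apply, LinearMap.smul_apply,
      hP.frame.normal _ (hm hx), smul_zero, Finset.sum_const_zero]
  · exact linearIndependent_jac_smul (hP.frame.independent _ (hm hx)) (hJ x hx)
  · refine eq_of_pd_eq_zero hO hc (f := fun x => B (∑ t, jac ψ i t x • n t (ψ x))
      (∑ t, jac ψ j t x • n t (ψ x)))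
      (fun y hy => differentiableAt_bilin B (hdn y hy i) (hdn y hy j)) (fun y hy a => ?_) hx hq
    rw [pd_bilin B (hdn y hy i) (hdn y hy j)]
    have h1 := htor y hy i j a
    have h2 := htor y hy j i a
    rw [torsionCoeff] at h1 h2
    rw [h1, zero_add]
    exact (hB.eq _ _).trans h2
  -- The Christoffel corrections to the second derivatives of r are tangent and drop out against the
  -- normals, so both sides are the same trilinear expression in the Jacobian.
  · rw [hΓ.pd_pd_pd_comp hO hψ hW hm (contDiffOn_firstForm hW hr.smooth) hr.nonisotropic hP.smooth
      hx, secondForm, hΓ.pd_pd_comp hO hψ hW hm hr.smooth hx]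
    simp only [← hP.second _ (hm hx), secondForm, map_sum, map_smul, map_sub, LinearMap.sum_apply,
      LinearMap.smul_apply, hP.frame.normal _ (hm hx), mul_zero, Finset.sum_const_zero, sub_zero,
      smul_eq_mul, Finset.mul_sum]
    conv_lhs => enter [2, j]; rw [Finset.sum_comm]
    rw [Finset.sum_comm]
    refine Finset.sum_congr rfl fun i _ => Finset.sum_congr rfl fun j _ =>
      Finset.sum_congr rfl fun k _ => ?_
    ring

end FlatCoordinates

/-- Near each point a potential flat torsionless submanifold has flat coordinates in which it is
given by a solution of the associativity equations. -/
theorem IsPotentialSubmanifold.exists_flat_coordinates {N : ℕ} {V : Type*} [NormedAddCommGroup V]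
    [NormedSpace ℝ V] [FiniteDimensional ℝ V] (hV : Module.finrank ℝ V = 2 * N)
    {B : LinearMap.BilinForm ℝ V} (hB : B.IsSymm) (hBnd : B.Nondegenerate)
    {Ω W : Set (Fin N → ℝ)} {r : (Fin N → ℝ) → V} (hr : IsPotentialSubmanifold B Ω r)
    {n : Fin N → (Fin N → ℝ) → V} {Φ : (Fin N → ℝ) → ℝ} (hW : IsOpen W) (hWΩ : W ⊆ Ω)
    (hP : IsPotential B W r n Φ) {p : Fin N → ℝ} (hp : p ∈ W) :
    ∃ (e : OpenPartialHomeomorph (Fin N → ℝ) (Fin N → ℝ)) (η μ : Matrix (Fin N) (Fin N) ℝ),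
      p ∈ e.target ∧ e.target ⊆ W ∧
      ContDiffOn ℝ ∞ e e.source ∧ ContDiffOn ℝ ∞ e.symm e.target ∧
      η.IsSymm ∧ η.det ≠ 0 ∧ μ.IsSymm ∧ μ.det ≠ 0 ∧
      HasFundamentalForms B η μ e.source (r ∘ e)
        (fun a x => ∑ i, pd a (fun y => e y i) x • n i (e x)) (Φ ∘ e) ∧
      SatisfiesWDVV η e.source (Φ ∘ e) := by
  have hrW : IsSubmanifold B W r := ⟨hr.submanifold.smooth.mono hWΩ,
    fun u hu => hr.submanifold.rank u (hWΩ hu), fun u hu => hr.submanifold.nonisotropic u (hWΩ hu)⟩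
  obtain ⟨e, hpe, heW, hes, hes', hc, hΓ, hJ⟩ := exists_flatChart hW
    (fun u => isSymm_firstForm hB u) (contDiffOn_firstForm hW hrW.smooth) hrW.nonisotropic
    (fun u hu => hr.flat u (hWΩ hu)) hp
  have hm : MapsTo e e.source W := fun x hx => heW (e.map_source hx)
  have hq : e.symm p ∈ e.source := e.map_target hpe
  have h := hasFundamentalForms_comp hB e.open_source hes hW hm hΓ hrW hc hJ hP hq
  have hne : e.source.Nonempty := ⟨_, hq⟩
  exact ⟨e, _, _, hpe, heW, hes, hes', h.isSymm_first hB hne, h.det_first_ne_zero hne,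
    h.isSymm_gram hB hne, h.det_gram_ne_zero hV hB hBnd hne, h,
    h.satisfiesWDVV hV hB hBnd e.open_source (hP.smooth.comp hes hm)⟩

end PotentialSubmanifold

/-! ### The main theorem. -/

theorem mainTheorem2 {N : ℕ} {V : Type*} [NormedAddCommGroup V] [NormedSpace ℝ V]
    [FiniteDimensional ℝ V] (hV : Module.finrank ℝ V = 2 * N)
    (B : LinearMap.BilinForm ℝ V) (hBsymm : B.IsSymm) (hBnd : B.Nondegenerate) :
    -- every solution is realized, and only solutions are realized
    (∀ (η : Matrix (Fin N) (Fin N) ℝ) (c : ℝ), η.IsSymm → η.det ≠ 0 → c ≠ 0 →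
      (∃ b : Module.Basis (Fin N ⊕ Fin N) ℝ V,
        ∀ s t, B (b s) (b t) = Matrix.fromBlocks η 0 0 (c⁻¹ • η) s t) →
      ∀ (Ω : Set (Fin N → ℝ)) (Φ : (Fin N → ℝ) → ℝ), IsOpen Ω → IsSimplyConnected Ω →
        ContDiffOn ℝ ∞ Φ Ω →
        (SatisfiesWDVV η Ω Φ ↔
          ∃ (r : (Fin N → ℝ) → V) (n : Fin N → (Fin N → ℝ) → V),
            IsPotentialSubmanifold B Ω r ∧ HasFundamentalForms B η (c⁻¹ • η) Ω r n Φ)) ∧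
    -- uniqueness up to motions; solutions are counted up to quadratic polynomials
    (∀ (η μ : Matrix (Fin N) (Fin N) ℝ) (Ω : Set (Fin N → ℝ)), IsOpen Ω → IsConnected Ω →
      ∀ (r r' : (Fin N → ℝ) → V) (n n' : Fin N → (Fin N → ℝ) → V) (Φ Φ' : (Fin N → ℝ) → ℝ),
        ContDiffOn ℝ ∞ Φ Ω → ContDiffOn ℝ ∞ Φ' Ω →
        HasFundamentalForms B η μ Ω r n Φ → HasFundamentalForms B η μ Ω r' n' Φ' →
        (EqualUpToMotion B Ω r n r' n' ↔
          ∃ (a : Fin N → Fin N → ℝ) (b : Fin N → ℝ) (d : ℝ), ∀ u ∈ Ω,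
            Φ' u = Φ u + ∑ i, ∑ j, a i j * u i * u j + ∑ i, b i * u i + d)) ∧
    -- every potential flat torsionless submanifold comes, in flat coordinates, from a solution
    (∀ (Ω : Set (Fin N → ℝ)) (r : (Fin N → ℝ) → V), IsOpen Ω → IsPotentialSubmanifold B Ω r →
      ∀ (W : Set (Fin N → ℝ)) (n : Fin N → (Fin N → ℝ) → V) (Φ : (Fin N → ℝ) → ℝ),
        IsOpen W → W ⊆ Ω → IsPotential B W r n Φ → ∀ p ∈ W,
        ∃ (e : OpenPartialHomeomorph (Fin N → ℝ) (Fin N → ℝ))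
          (η μ : Matrix (Fin N) (Fin N) ℝ),
          p ∈ e.target ∧ e.target ⊆ W ∧
          ContDiffOn ℝ ∞ e e.source ∧ ContDiffOn ℝ ∞ e.symm e.target ∧
          η.IsSymm ∧ η.det ≠ 0 ∧ μ.IsSymm ∧ μ.det ≠ 0 ∧
          HasFundamentalForms B η μ e.source (r ∘ e)
            (fun a x => ∑ i, pd a (fun y => e y i) x • n i (e x)) (Φ ∘ e) ∧
          SatisfiesWDVV η e.source (Φ ∘ e)) := by
  refine ⟨?_, ?_, ?_⟩
  · rintro η c hηs hη hc ⟨b, hb⟩ Ω Φ hΩ hsc hΦ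
    exact satisfiesWDVV_iff hV hBsymm hBnd hηs hη hc b hb hΩ hsc hΦ
  · intro η μ Ω hΩ hc r r' n n' Φ Φ' hΦ hΦ' h h'
    exact equalUpToMotion_iff hV hBsymm hBnd hΩ hc hΦ hΦ' h h'
  · intro Ω r _ hr W n Φ hW hWΩ hP p hp
    exact hr.exists_flat_coordinates hV hBsymm hBnd hW hWΩ hP hp
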